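/- **Setting.** Let $d\ge 2$, let $\Omega\subset\mathbb R^d$ be open, and let $\mathcal T_h$ be a finite family of convex polytopes $K$ (the elements; closed, with nonempty interior) with pairwise disjoint interiors, $\operatorname{int}K\subset\Omega$ and $\bigcup_K K=\overline\Omega$. Write $\bm n$ for the outward unit normal on $\partial K$. An interior face is a set $\partial K^+\cap\partial K^-$, $K^+\ne K^-$, of nonzero $(d-1)$-dimensional measure. Put $(v,w)_{\mathcal T_h}=\sum_K\int_K vw$, and let $\langle v,w\rangle_{\partial\mathcal T_h}$, $\langle v,w\rangle_{o}$, $\langle v,w\rangle_{\partial}$ denote $\sum_K\int vw$ over $\partial K$, $\partial K\setminus\partial\Omega$ and $\partial K\cap\partial\Omega$ respectively. For $k\ge0$ let $\bm V_h$ and $W_h$ be the spaces of vector fields, resp. functions, that are on each $K$ (componentwise) polynomials of degree at most $k$, resp. $k+1$, and let $\widetilde M_h(o)$ be the space of continuous functions on the union of the interior faces that are polynomials of degree at most $k+1$ on each interior face. On $\bm V_h$ and $W_h$, $\nabla$ and $\nabla\cdot$ are taken elementwise. Let $\bm\beta$ be a Lipschitz vector field on $\overline\Omega$, $f,y_d\in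 L^2(\Omega)$, $g\in C^0(\partial\Omega)$, $\mathcal I_h g$ a continuous function on $\partial\Omega$ (the image of $g$ under an arbitrary operator $\mathcal I_h:C^0(\partial\Omega)\to C^0(\partial\Omega)$, for instance an interpolation operator), $\gamma>0$, $h>0$, and let the stabilization functions $\tau_1,\tau_2$ be integrable functions on the boundaries $\partial K$ (they may take different values from the two sides of an interior face). **OD system.** For $\bm q,\bm p\in\bm V_h$, $y,z,u\in W_h$, $\widehat y,\widehat z\in\widetilde M_h(o)$ set $\widehat{\bm q}\cdot\bm n=\bm q\cdot\bm n+(h^{-1}+\tau_1)(y-\widehat y)$ and $\widehat{\bm p}\cdot\bm n=\bm p\cdot\bm n+(h^{-1}+\tau_2)(z-\widehat z)$ on $\partial K\setminus\partial\Omega$, and $\widehat{\bm q}\cdot\bm n=\bm q\cdot\bm n+(h^{-1}+\tau_1)(y-\mathcal I_hg)$ and $\widehat{\bm p}\cdot\bm n=\bm p\cdot\bm n+(h^{-1}+\tau_2)z$ on $\partial K\cap\partial\Omega$. The EDG discretization of the continuous optimality system is: for all $\bm r\in\bm V_h$, $w\in W_h$, $\mu\in\widetilde M_h(o)$, $$\begin{aligned}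 &(\bm q,\bm r)_{\mathcal T_h}-(y,\nabla\cdot\bm r)_{\mathcal T_h}+\langle\widehat y,\bm r\cdot\bm n\rangle_{o}=-\langle\mathcal I_hg,\bm r\cdot\bm n\rangle_{\partial},\\ &-(\bm q+\bm\beta y,\nabla w)_{\mathcal T_h}-(y\nabla\cdot\bm\beta,w)_{\mathcal T_h}+\langle\widehat{\bm q}\cdot\bm n,w\rangle_{\partial\mathcal T_h}+\langle\bm\beta\cdot\bm n\,\widehat y,w\rangle_{o}-(u,w)_{\mathcal T_h}=-\langle\bm\beta\cdot\bm n\,\mathcal I_hg,w\rangle_{\partial}+(f,w)_{\mathcal T_h},\\ &\langle\widehat{\bm q}\cdot\bm n+\bm\beta\cdot\bm n\,\widehat y,\mu\rangle_{o}=0,\\ &A_1(\bm r):=(\bm p,\bm r)_{\mathcal T_h}-(z,\nabla\cdot\bm r)_{\mathcal T_h}+\langle\widehat z,\bm r\cdot\bm n\rangle_{o}=0,\\ &A_2(w):=-(\bm p-\bm\beta z,\nabla w)_{\mathcal T_h}+\langle\widehat{\bm p}\cdot\bm n,w\rangle_{\partial\mathcal T_h}-\langle\bm\beta\cdot\bm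 n\,\widehat z,w\rangle_{o}-(y-y_d,w)_{\mathcal T_h}=0,\\ &A_3(\mu):=\langle\widehat{\bm p}\cdot\bm n-\bm\beta\cdot\bm n\,\widehat z,\mu\rangle_{o}=0,\\ &A_4(w):=(z+\gamma u,w)_{\mathcal T_h}=0. \end{aligned}$$ **DO approach.** The discrete control problem is to minimize $J(y,u)=\frac12\|y-y_d\|_{\mathcal T_h}^2+\frac\gamma2\|u\|_{\mathcal T_h}^2$ over $(\bm q,y,\widehat y,u)\in\bm V_h\times W_h\times\widetilde M_h(o)\times W_h$ subject to the discrete state equations: for all $\bm r\in\bm V_h$, $w\in W_h$, $\mu\in\widetilde M_h(o)$, $$\begin{aligned} &(\bm q,\bm r)_{\mathcal T_h}-(y,\nabla\cdot\bm r)_{\mathcal T_h}+\langle\widehat y,\bm r\cdot\bm n\rangle_{o}=-\langle\mathcal I_hg,\bm r\cdot\bm n\rangle_{\partial},\\ &-(\bm q+\bm\beta y,\nabla w)_{\mathcal T_h}-(y\nabla\cdot\bm\beta,w)_{\mathcal T_h}+\langle\bm q\cdot\bm n,w\rangle_{\partial\mathcal T_h}+\langle(h^{-1}+\tau_1)y,w\rangle_{\partial\mathcal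 T_h}+\langle(\bm\beta\cdot\bm n-h^{-1}-\tau_1)\widehat y,w\rangle_{o}-(u,w)_{\mathcal T_h}\\ &\qquad=-\langle(\bm\beta\cdot\bm n-h^{-1}-\tau_1)\mathcal I_hg,w\rangle_{\partial}+(f,w)_{\mathcal T_h},\\ &\langle\bm q\cdot\bm n+(h^{-1}+\tau_1)(y-\widehat y),\mu\rangle_{o}=0. \end{aligned}$$ The discrete Lagrangian $\mathcal L_h(\bm q,y,\widehat y,u;\bm p,z,\widehat z)$ is $J(y,u)$, plus (left minus right side) of the first equation with $\bm r=\bm p$, minus (left minus right side) of the second with $w=z$, plus the left side of the third with $\mu=\widehat z$. The DO system consists of the discrete state equations together with the vanishing of the partial Fréchet derivatives of $\mathcal L_h$ with respect to $\bm q$, $y$, $\widehat y$ (the discrete adjoint equations) and $u$ (the optimality condition). **Claim (OD = DO).** Suppose $\tau_2=\tau_1-\bm\beta\cdot\bm n$ almost everywhere on $\partial K$ for every $K\in\mathcal T_h$. Then: 1. For all arguments, the partial Fréchet derivatives of $\mathcal L_h$ exist and are given by $\frac{\partial\mathcal L_h}{\partial\bm q}\bm r=A_1(\bm r)$, $\frac{\partial\mathcal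 L_h}{\partial y}w=-A_2(w)$, $\frac{\partial\mathcal L_h}{\partial\widehat y}\mu=A_3(\mu)$, $\frac{\partial\mathcal L_h}{\partial u}w=A_4(w)$. Thus the discrete adjoint equations and the optimality condition of the two approaches coincide. 2. $(\bm q,y,\widehat y,u,\bm p,z,\widehat z)$ solves the DO system if and only if it solves the OD system. 3. $(\bm q,y,\widehat y,u)$ is a solution of the discrete control problem if and only if there are $(\bm p,z,\widehat z)\in\bm V_h\times W_h\times\widetilde M_h(o)$ such that $(\bm q,y,\widehat y,u,\bm p,z,\widehat z)$ solves the OD system. So under this condition the method is commutative. -/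

import Mathlib

noncomputable section

namespace EDG

open MeasureTheory

/-- Euclidean space `ℝ^d`. -/
abbrev E (d : ℕ) := EuclideanSpace ℝ (Fin d)

/-- The `(d-1)`-dimensional Lebesgue measure on hypersurfaces of `ℝ^d`: the Hausdorff measure of
dimension `d - 1`, normalised to agree with Lebesgue measure on hyperplanes. -/
def surfaceMeasure (d : ℕ) : Measure (E d) := Measure.euclideanHausdorffMeasure (d - 1)

/-! ### Meshes -/

/-- A convex polytope in `ℝ^d` with nonempty interior, as a bounded finite intersection of
half-spaces `{x | n · x ≤ b}` with unit outward normal `n`, each given by the pair `(n, b)`. -/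
structure ConvexPolytope (d : ℕ) where
  halfspaces : Finset (E d × ℝ)
  norm_normal : ∀ s ∈ halfspaces, ‖s.1‖ = 1
  isBounded : Bornology.IsBounded {x : E d | ∀ s ∈ halfspaces, inner ℝ s.1 x ≤ s.2}
  nonempty_interior : (interior {x : E d | ∀ s ∈ halfspaces, inner ℝ s.1 x ≤ s.2}).Nonempty

/-- The (closed) set of points of the polytope. -/
def ConvexPolytope.carrier {d : ℕ} (K : ConvexPolytope d) : Set (E d) :=
  {x | ∀ s ∈ K.halfspaces, inner ℝ s.1 x ≤ s.2}

/-- The part of the boundary of the polytope that lies on the hyperplane `n · x = b`,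
where `s = (n, b)`. On it the outward unit normal of the polytope is `n`. -/
def ConvexPolytope.facet {d : ℕ} (K : ConvexPolytope d) (s : E d × ℝ) : Set (E d) :=
  {x | x ∈ K.carrier ∧ inner ℝ s.1 x = s.2}

theorem ConvexPolytope.isCompact_carrier {d : ℕ} (K : ConvexPolytope d) :
    IsCompact K.carrier := by
  refine Metric.isCompact_of_isClosed_isBounded ?_ K.isBounded
  have h : K.carrier = ⋂ s ∈ K.halfspaces, {x : E d | inner ℝ s.1 x ≤ s.2} := by
    ext x
    simp [ConvexPolytope.carrier]
  rw [h]
  refine isClosed_biInter fun s _ => ?_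
  exact isClosed_le (by fun_prop) continuous_const

/-- A finite collection of elements (convex polytopes) with pairwise disjoint interiors that
partitions `Ω`. -/
structure Mesh {d : ℕ} (Ω : Set (E d)) (ι : Type*) where
  cell : ι → ConvexPolytope d
  interior_subset : ∀ i, interior (cell i).carrier ⊆ Ω
  disjoint_interior : ∀ i j, i ≠ j →
    Disjoint (interior (cell i).carrier) (interior (cell j).carrier)
  iUnion_carrier : ⋃ i, (cell i).carrier = closure Ω

section Skeleton

variable {d : ℕ} {Ω : Set (E d)} {ι : Type*} (T : Mesh Ω ι)

/-- The common boundary `∂K⁺ ∩ ∂K⁻` of two elements. -/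
def Mesh.commonFace (i j : ι) : Set (E d) :=
  frontier (T.cell i).carrier ∩ frontier (T.cell j).carrier

/-- `∂K⁺ ∩ ∂K⁻` is an interior face: two different elements, nonzero `(d-1)`-measure. -/
def Mesh.IsInteriorFace (i j : ι) : Prop :=
  i ≠ j ∧ surfaceMeasure d (T.commonFace i j) ≠ 0

/-- The union of all interior faces. -/
def Mesh.interiorSkeleton : Set (E d) :=
  ⋃ i, ⋃ j, ⋃ _ : T.IsInteriorFace i j, T.commonFace i j

theorem Mesh.isCompact_interiorSkeleton [Fintype ι] : IsCompact T.interiorSkeleton := by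
  refine isCompact_iUnion fun i => isCompact_iUnion fun j => ?_
  by_cases h : T.IsInteriorFace i j
  · simp only [h, Set.iUnion_true]
    have hi := (T.cell i).isCompact_carrier
    have hc : IsCompact (frontier (T.cell i).carrier) :=
      hi.of_isClosed_subset isClosed_frontier hi.isClosed.frontier_subset
    exact hc.inter_right isClosed_frontier
  · simp [h]

instance [Fintype ι] : CompactSpace T.interiorSkeleton :=
  isCompact_iff_compactSpace.mp T.isCompact_interiorSkeleton

end Skeleton

/-! ### Discrete spaces -/

/-- Polynomials on `ℝ^d` of total degree at most `m`. Since elements have nonempty interior, this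
is also the space `P^m(K)` for every element `K`. -/
def Poly (d m : ℕ) : Type := MvPolynomial.restrictTotalDegree (Fin d) ℝ m

instance (d m : ℕ) : AddCommGroup (Poly d m) :=
  inferInstanceAs (AddCommGroup (MvPolynomial.restrictTotalDegree (Fin d) ℝ m))

instance (d m : ℕ) : Module ℝ (Poly d m) :=
  inferInstanceAs (Module ℝ (MvPolynomial.restrictTotalDegree (Fin d) ℝ m))

instance (d m : ℕ) : Module.Finite ℝ (Poly d m) :=
  inferInstanceAs (Module.Finite ℝ (MvPolynomial.restrictTotalDegree (Fin d) ℝ m))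

/-- The underlying polynomial. -/
def Poly.toMv {d m : ℕ} : Poly d m →ₗ[ℝ] MvPolynomial (Fin d) ℝ :=
  (MvPolynomial.restrictTotalDegree (Fin d) ℝ m).subtype

/-- A norm on the finite-dimensional space of polynomials (the sup norm of the coordinates in a
basis); all norms are equivalent, so Fréchet derivatives do not depend on the choice. -/
instance (d m : ℕ) : NormedAddCommGroup (Poly d m) :=
  NormedAddCommGroup.induced (Poly d m) (Fin (Module.finrank ℝ (Poly d m)) → ℝ)
    (Module.finBasis ℝ (Poly d m)).equivFun.toLinearMap
    (Module.finBasis ℝ (Poly d m)).equivFun.injective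

instance (d m : ℕ) : NormedSpace ℝ (Poly d m) :=
  NormedSpace.induced ℝ (Poly d m) (Fin (Module.finrank ℝ (Poly d m)) → ℝ)
    (Module.finBasis ℝ (Poly d m)).equivFun.toLinearMap

/-- Value of a polynomial at a point. -/
def polyEval {d : ℕ} (p : MvPolynomial (Fin d) ℝ) (x : E d) : ℝ :=
  MvPolynomial.eval (fun j => x j) p

/-- `V_h`: on each element, a vector field with components of degree at most `k`. -/
abbrev Vh (d : ℕ) (ι : Type*) (k : ℕ) := ι → Fin d → Poly d k

/-- `W_h`: on each element, a polynomial of degree at most `k + 1`. -/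
abbrev Wh (d : ℕ) (ι : Type*) (k : ℕ) := ι → Poly d (k + 1)

/-- The space `M̃_h(o)` of continuous functions on the union of the interior faces that are, on
each interior face, polynomials of degree at most `k + 1`. -/
def traceSubmodule {d : ℕ} {Ω : Set (E d)} {ι : Type*} (T : Mesh Ω ι) (k : ℕ) :
    Submodule ℝ C(T.interiorSkeleton, ℝ) where
  carrier := {μ | ∀ i j, T.IsInteriorFace i j → ∃ p : Poly d (k + 1),
    ∀ x : T.interiorSkeleton, (x : E d) ∈ T.commonFace i j → μ x = polyEval p.toMv x}
  add_mem' := by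
    intro a b ha hb i j hij
    obtain ⟨p, hp⟩ := ha i j hij
    obtain ⟨p', hp'⟩ := hb i j hij
    exact ⟨p + p', fun x hx => by simp [hp x hx, hp' x hx, polyEval]⟩
  zero_mem' := fun i j _ => ⟨0, fun x _ => by simp [polyEval]⟩
  smul_mem' := by
    intro c a ha i j hij
    obtain ⟨p, hp⟩ := ha i j hij
    exact ⟨c • p, fun x hx => by simp [hp x hx, polyEval]⟩

/-- The space `M̃_h(o)` as a type, with the sup norm. -/
def Mo {d : ℕ} {Ω : Set (E d)} {ι : Type*} (T : Mesh Ω ι) (k : ℕ) : Type := traceSubmodule T k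

/-- The underlying continuous function on the union of the interior faces. -/
def Mo.toFun {d : ℕ} {Ω : Set (E d)} {ι : Type*} {T : Mesh Ω ι} {k : ℕ} (μ : Mo T k) :
    C(T.interiorSkeleton, ℝ) := Subtype.val (p := (· ∈ traceSubmodule T k)) μ

instance {d : ℕ} {Ω : Set (E d)} {ι : Type*} [Fintype ι] (T : Mesh Ω ι) (k : ℕ) :
    NormedAddCommGroup (Mo T k) :=
  inferInstanceAs (NormedAddCommGroup (traceSubmodule T k))

instance {d : ℕ} {Ω : Set (E d)} {ι : Type*} [Fintype ι] (T : Mesh Ω ι) (k : ℕ) :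
    NormedSpace ℝ (Mo T k) :=
  inferInstanceAs (NormedSpace ℝ (traceSubmodule T k))

section Operations

variable {d : ℕ} {ι : Type*}

/-- A function on the elements: `φ i x` is the value at `x` of the branch on the element `i`. -/
abbrev CellFun (d : ℕ) (ι : Type*) := ι → E d → ℝ

/-- A vector field on the elements. -/
abbrev CellField (d : ℕ) (ι : Type*) := ι → E d → E d

/-- A function on the element boundaries: `φ i n x` is the value on the boundary of the element
`i`, at the point `x` of the facet with outward unit normal `n`. -/
abbrev BdryFun (d : ℕ) (ι : Type*) := ι → E d → E d → ℝ

/-- The value of `w` in `W_h`. -/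
def val {k : ℕ} (w : Wh d ι k) : CellFun d ι := fun i x => polyEval (w i).toMv x

/-- The value of `r` in `V_h`. -/
def vval {k : ℕ} (r : Vh d ι k) : CellField d ι :=
  fun i x => WithLp.toLp 2 fun j => polyEval (r i j).toMv x

/-- The elementwise gradient `∇w`. -/
def grad {k : ℕ} (w : Wh d ι k) : CellField d ι :=
  fun i x => WithLp.toLp 2 fun j => polyEval (MvPolynomial.pderiv j (w i).toMv) x

/-- The elementwise divergence `∇·r`. -/
def div {k : ℕ} (r : Vh d ι k) : CellFun d ι :=
  fun i x => ∑ j, polyEval (MvPolynomial.pderiv j (r i j).toMv) x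

/-- The trace of `w` on the element boundaries. -/
def tr {k : ℕ} (w : Wh d ι k) : BdryFun d ι := fun i _ x => polyEval (w i).toMv x

/-- The normal trace `r · n` on the element boundaries. -/
def ntr {k : ℕ} (r : Vh d ι k) : BdryFun d ι := fun i n x => inner ℝ (vval r i x) n

open Classical in
/-- A function on a subset of `ℝ^d`, seen as a single-valued function on the element boundaries
(with value `0` away from the subset). -/
def single {S : Set (E d)} (μ : C(S, ℝ)) : BdryFun d ι :=
  fun _ _ x => if hx : x ∈ S then μ ⟨x, hx⟩ else 0

/-- The divergence of a vector field on `ℝ^d`, defined where the field is differentiable. -/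
def fieldDiv (β : E d → E d) (x : E d) : ℝ :=
  ∑ j, (fderiv ℝ β x (EuclideanSpace.single j 1)) j

end Operations

section Pairings

variable {d : ℕ} {Ω : Set (E d)} {ι : Type*} [Fintype ι] (T : Mesh Ω ι)

/-- `(φ, ψ)_{T_h}` for scalar functions. -/
def Mesh.ip (φ ψ : CellFun d ι) : ℝ :=
  ∑ i, ∫ x in (T.cell i).carrier, φ i x * ψ i x

/-- `(φ, ψ)_{T_h}` for vector fields. -/
def Mesh.vip (φ ψ : CellField d ι) : ℝ :=
  ∑ i, ∫ x in (T.cell i).carrier, inner ℝ (φ i x) (ψ i x)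

/-- The sum over all elements `K` of the integral of `φ ψ` over `∂K ∩ S`. -/
def Mesh.bipOn (S : Set (E d)) (φ ψ : BdryFun d ι) : ℝ :=
  ∑ i, ∑ s ∈ (T.cell i).halfspaces,
    ∫ x in (T.cell i).facet s ∩ S, φ i s.1 x * ψ i s.1 x ∂(surfaceMeasure d)

/-- `⟨φ, ψ⟩` on `∂T_h`. -/
def Mesh.bip (φ ψ : BdryFun d ι) : ℝ := T.bipOn Set.univ φ ψ

/-- `⟨φ, ψ⟩` on the interior part of `∂T_h` (boundary faces removed). -/
def Mesh.bipInt (φ ψ : BdryFun d ι) : ℝ := T.bipOn (frontier Ω)ᶜ φ ψ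

/-- `⟨φ, ψ⟩` on the boundary faces. -/
def Mesh.bipBd (φ ψ : BdryFun d ι) : ℝ := T.bipOn (frontier Ω) φ ψ

end Pairings

/-! ### Data of the control problem and of the method -/

/-- The data: convection field `β`, source `f`, desired state `y_d`, continuous Dirichlet datum
`g`, an operator `Ih` with values in the continuous functions on the boundary, control weight `γ`,
mesh parameter `h`, and the stabilization functions on the element boundaries. -/
structure Data {d : ℕ} {Ω : Set (E d)} {ι : Type*} (T : Mesh Ω ι) where
  β : E d → E d
  lipschitz_β : ∃ C, LipschitzOnWith C β (closure Ω)
  f : E d → ℝ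
  memLp_f : MemLp f 2 (volume.restrict Ω)
  yd : E d → ℝ
  memLp_yd : MemLp yd 2 (volume.restrict Ω)
  g : C(frontier Ω, ℝ)
  Ih : C(frontier Ω, ℝ) → C(frontier Ω, ℝ)
  γ : ℝ
  γ_pos : 0 < γ
  h : ℝ
  h_pos : 0 < h
  τ₁ : BdryFun d ι
  integrable_τ₁ : ∀ i, ∀ s ∈ (T.cell i).halfspaces,
    IntegrableOn (τ₁ i s.1) ((T.cell i).facet s) (surfaceMeasure d)
  τ₂ : BdryFun d ι
  integrable_τ₂ : ∀ i, ∀ s ∈ (T.cell i).halfspaces,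
    IntegrableOn (τ₂ i s.1) ((T.cell i).facet s) (surfaceMeasure d)

section Systems

variable {d : ℕ} {Ω : Set (E d)} {ι : Type*} {T : Mesh Ω ι} (D : Data T) {k : ℕ}

/-- `I_h g` on the element boundaries. -/
def Data.Ig : BdryFun d ι := single (D.Ih D.g)

/-- `β · n` on the element boundaries. -/
def Data.βn : BdryFun d ι := fun _ n x => inner ℝ (D.β x) n

/-- `h⁻¹` on the element boundaries. -/
def Data.hinv : BdryFun d ι := fun _ _ _ => D.h⁻¹

/-- The vector field `β w`. -/
def Data.βmul (w : Wh d ι k) : CellField d ι := fun i x => val w i x • D.β x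

/-- The function `w ∇·β`. -/
def Data.divβ (w : Wh d ι k) : CellFun d ι := fun i x => val w i x * fieldDiv D.β x

/-- The source `f` on the elements. -/
def Data.fc : CellFun d ι := fun _ x => D.f x

/-- The desired state `y_d` on the elements. -/
def Data.ydc : CellFun d ι := fun _ x => D.yd x

open Classical in
/-- The numerical trace `q̂_h · n` of the state flux. -/
def Data.qhat (q : Vh d ι k) (y : Wh d ι k) (yo : Mo T k) : BdryFun d ι := fun i n x =>
  if x ∈ frontier Ω then
    ntr q i n x + D.h⁻¹ * (tr y i n x - D.Ig i n x) + D.τ₁ i n x * (tr y i n x - D.Ig i n x)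
  else
    ntr q i n x + D.h⁻¹ * (tr y i n x - single yo.toFun i n x)
      + D.τ₁ i n x * (tr y i n x - single yo.toFun i n x)

open Classical in
/-- The numerical trace `p̂_h · n` of the adjoint flux. -/
def Data.phat (p : Vh d ι k) (z : Wh d ι k) (zo : Mo T k) : BdryFun d ι := fun i n x =>
  if x ∈ frontier Ω then
    ntr p i n x + D.h⁻¹ * tr z i n x + D.τ₂ i n x * tr z i n x
  else
    ntr p i n x + D.h⁻¹ * (tr z i n x - single zo.toFun i n x)
      + D.τ₂ i n x * (tr z i n x - single zo.toFun i n x)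

variable [Fintype ι]

/-! #### Optimize-then-discretize -/

/-- Residual (left minus right side) of the discrete adjoint flux equation. -/
def odAdjFlux (p : Vh d ι k) (z : Wh d ι k) (zo : Mo T k) (r : Vh d ι k) : ℝ :=
  T.vip (vval p) (vval r) - T.ip (val z) (div r) + T.bipInt (single zo.toFun) (ntr r)

/-- Residual (left minus right side) of the discrete adjoint equation tested with `W_h`. -/
def Data.odAdjState (y : Wh d ι k) (p : Vh d ι k) (z : Wh d ι k) (zo : Mo T k)
    (w : Wh d ι k) : ℝ :=
  (-T.vip (vval p - D.βmul z) (grad w) + T.bip (D.phat p z zo) (tr w)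
    - T.bipInt (D.βn * single zo.toFun) (tr w) - T.ip (val y) (val w))
  - -T.ip D.ydc (val w)

/-- Residual of the discrete adjoint equation tested with `M̃_h(o)`. -/
def Data.odAdjTrace (p : Vh d ι k) (z : Wh d ι k) (zo : Mo T k) (μ : Mo T k) : ℝ :=
  T.bipInt (D.phat p z zo - D.βn * single zo.toFun) (single μ.toFun)

/-- Residual of the discrete optimality condition. -/
def Data.odControl (u z : Wh d ι k) (w : Wh d ι k) : ℝ :=
  T.ip (val z + D.γ • val u) (val w)

/-- The EDG discretization of the continuous optimality system. -/
structure Data.ODSystem (q : Vh d ι k) (y : Wh d ι k) (yo : Mo T k) (u : Wh d ι k)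
    (p : Vh d ι k) (z : Wh d ι k) (zo : Mo T k) : Prop where
  state_flux : ∀ r : Vh d ι k,
    T.vip (vval q) (vval r) - T.ip (val y) (div r) + T.bipInt (single yo.toFun) (ntr r)
      = -T.bipBd D.Ig (ntr r)
  state : ∀ w : Wh d ι k,
    -T.vip (vval q + D.βmul y) (grad w) - T.ip (D.divβ y) (val w)
      + T.bip (D.qhat q y yo) (tr w) + T.bipInt (D.βn * single yo.toFun) (tr w)
      - T.ip (val u) (val w)
      = -T.bipBd (D.βn * D.Ig) (tr w) + T.ip D.fc (val w)
  state_trace : ∀ μ : Mo T k,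
    T.bipInt (D.qhat q y yo + D.βn * single yo.toFun) (single μ.toFun) = 0
  adj_flux : ∀ r : Vh d ι k, odAdjFlux p z zo r = 0
  adj_state : ∀ w : Wh d ι k, D.odAdjState y p z zo w = 0
  adj_trace : ∀ μ : Mo T k, D.odAdjTrace p z zo μ = 0
  control : ∀ w : Wh d ι k, D.odControl u z w = 0

/-! #### Discretize-then-optimize -/

/-- The discrete cost functional. -/
def Data.cost (y u : Wh d ι k) : ℝ :=
  1 / 2 * T.ip (val y - D.ydc) (val y - D.ydc) + D.γ / 2 * T.ip (val u) (val u)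

/-- The discrete state equations, which are the constraints of the discrete control problem. -/
structure Data.DOState (q : Vh d ι k) (y : Wh d ι k) (yo : Mo T k) (u : Wh d ι k) : Prop where
  flux : ∀ r : Vh d ι k,
    T.vip (vval q) (vval r) - T.ip (val y) (div r) + T.bipInt (single yo.toFun) (ntr r)
      = -T.bipBd D.Ig (ntr r)
  state : ∀ w : Wh d ι k,
    -T.vip (vval q + D.βmul y) (grad w) - T.ip (D.divβ y) (val w) + T.bip (ntr q) (tr w)
      + T.bip ((D.hinv + D.τ₁) * tr y) (tr w)
      + T.bipInt ((D.βn - (D.hinv + D.τ₁)) * single yo.toFun) (tr w) - T.ip (val u) (val w)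
      = -T.bipBd ((D.βn - (D.hinv + D.τ₁)) * D.Ig) (tr w) + T.ip D.fc (val w)
  trace : ∀ μ : Mo T k,
    T.bipInt (ntr q + (D.hinv + D.τ₁) * (tr y - single yo.toFun)) (single μ.toFun) = 0

/-- A solution of the discrete control problem: a feasible point of minimal cost. -/
def Data.IsDiscreteMinimizer (q : Vh d ι k) (y : Wh d ι k) (yo : Mo T k) (u : Wh d ι k) : Prop :=
  D.DOState q y yo u ∧
    ∀ (q' : Vh d ι k) (y' : Wh d ι k) (yo' : Mo T k) (u' : Wh d ι k),
      D.DOState q' y' yo' u' → D.cost y u ≤ D.cost y' u'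

/-- The discrete Lagrangian functional. -/
def Data.lagrangian (q : Vh d ι k) (y : Wh d ι k) (yo : Mo T k) (u : Wh d ι k)
    (p : Vh d ι k) (z : Wh d ι k) (zo : Mo T k) : ℝ :=
  1 / 2 * T.ip (val y - D.ydc) (val y - D.ydc) + D.γ / 2 * T.ip (val u) (val u)
  + T.vip (vval q) (vval p) - T.ip (val y) (div p) + T.bipInt (single yo.toFun) (ntr p)
  + T.bipBd D.Ig (ntr p)
  + T.vip (vval q + D.βmul y) (grad z) + T.ip (D.divβ y) (val z) - T.bip (ntr q) (tr z)
  - T.bip ((D.hinv + D.τ₁) * tr y) (tr z)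
  - T.bipInt ((D.βn - D.hinv - D.τ₁) * single yo.toFun) (tr z)
  + T.ip (val u) (val z)
  - T.bipBd ((D.βn - D.hinv - D.τ₁) * D.Ig) (tr z) + T.ip D.fc (val z)
  + T.bipInt (ntr q + (D.hinv + D.τ₁) * (tr y - single yo.toFun)) (single zo.toFun)

/-- The discretize-then-optimize system: the discrete state equations, together with the vanishing
of the partial Fréchet derivatives of the Lagrangian with respect to flux, state, numerical trace
(the discrete adjoint equations) and control (the optimality condition). -/
structure Data.DOSystem (q : Vh d ι k) (y : Wh d ι k) (yo : Mo T k) (u : Wh d ι k)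
    (p : Vh d ι k) (z : Wh d ι k) (zo : Mo T k) : Prop where
  state : D.DOState q y yo u
  deriv_flux : HasFDerivAt (fun q' => D.lagrangian q' y yo u p z zo) (0 : Vh d ι k →L[ℝ] ℝ) q
  deriv_state : HasFDerivAt (fun y' => D.lagrangian q y' yo u p z zo) (0 : Wh d ι k →L[ℝ] ℝ) y
  deriv_trace : HasFDerivAt (fun yo' => D.lagrangian q y yo' u p z zo) (0 : Mo T k →L[ℝ] ℝ) yo
  deriv_control : HasFDerivAt (fun u' => D.lagrangian q y yo u' p z zo) (0 : Wh d ι k →L[ℝ] ℝ) u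

end Systems

end EDG

end

noncomputable section

namespace EDG

open MeasureTheory

/-! ### Integration along a direction transversal to a hyperplane -/

section Hyperplane

variable {d : ℕ}

/-! The Lagrangian is the quadratic cost plus a form bilinear in the primal unknowns and the
multipliers plus a load depending on the multipliers alone (`Data.lagrangian_eq`). Its partial
derivatives are therefore read off from an exact quadratic expansion, and the work lies in
recognizing them as the OD adjoint residuals.

Two elementwise Green formulas do this. The one for polynomial fields (`Mesh.vip_vval_grad`)
exchanges gradient and divergence. The one for `β` against a product of polynomials
(`Data.vip_βmul_grad`) moves the convection term onto the test function and leaves a boundary term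
with weight `β·n`. This weight joins `h⁻¹ + τ₁` to give `h⁻¹ + τ₁ - β·n`, which is `h⁻¹ + τ₂` by
assumption.

The state equations of the two approaches differ by regrouping and by the pairing of `β·n ŷ` with
`μ` over the interior parts of the element boundaries. That pairing vanishes because `β`, `ŷ`, `μ`
are single-valued and the outward normals sum to zero almost everywhere on the facets inside `Ω`
(`Mesh.ae_normalSum_eq_zero`). Elements need not meet facet to facet, so the cancellation is proved
weakly: summing the divergence theorem over the elements gives zero for every smooth function with
compact support in `Ω`.

The divergence theorem for Lipschitz functions on polytopes (`ConvexPolytope.setIntegral_fderiv`)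
comes from writing a compactly supported function at a facet point as the integral of its line
derivative along a ray. By Fubini this becomes an integral over the shadow of the facet, and the
signed shadows of all facets add up to the indicator of the polytope.

For the minimizers, the cost is convex and quadratic and the feasible set is affine in a
finite-dimensional space. Stationarity along the feasible directions is thus necessary and
sufficient, and a functional vanishing on the kernel of the constraint form is represented by a
multiplier (`exists_multiplier`); neither solvability nor uniqueness for the state equations is
needed. -/

theorem finrank_orthogonal_span {n : E d} (hn : ‖n‖ = 1) :
    Module.finrank ℝ (ℝ ∙ n)ᗮ = d - 1 := by
  have h := Submodule.finrank_add_finrank_orthogonal (ℝ ∙ n)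
  rw [finrank_span_singleton (by rintro rfl; simp at hn), finrank_euclideanSpace_fin] at h
  omega

theorem inner_orthogonal_span {n : E d} (w : (ℝ ∙ n)ᗮ) : inner ℝ n (w : E d) = 0 :=
  Submodule.mem_orthogonal_singleton_iff_inner_right.1 w.2

/-- The isometric parametrization of the hyperplane `n · x = b` by the orthogonal complement of
its unit normal. -/
def hyperplaneParam (n : E d) (b : ℝ) (w : (ℝ ∙ n)ᗮ) : E d := b • n + w

theorem isometry_hyperplaneParam (n : E d) (b : ℝ) : Isometry (hyperplaneParam n b) :=
  (isometry_add_left (b • n)).comp isometry_subtype_coe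

theorem range_hyperplaneParam {n : E d} (hn : ‖n‖ = 1) (b : ℝ) :
    Set.range (hyperplaneParam n b) = {x | inner ℝ n x = b} := by
  ext x
  constructor
  · rintro ⟨w, rfl⟩
    simp [hyperplaneParam, inner_add_right, inner_smul_right, inner_orthogonal_span, hn]
  · intro hx
    refine ⟨⟨x - b • n, ?_⟩, by simp [hyperplaneParam]⟩
    rw [Submodule.mem_orthogonal_singleton_iff_inner_right]
    have hx' : inner ℝ n x = b := hx
    simp [inner_sub_right, inner_smul_right, hn, hx']

theorem map_hyperplaneParam {n : E d} (hn : ‖n‖ = 1) (b : ℝ) :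
    Measure.map (hyperplaneParam n b) volume
      = (surfaceMeasure d).restrict {x | inner ℝ n x = b} := by
  rw [← range_hyperplaneParam hn b, surfaceMeasure,
    ← (isometry_hyperplaneParam n b).map_euclideanHausdorffMeasure, ← finrank_orthogonal_span hn,
    InnerProductSpace.euclideanHausdorffMeasure_eq_volume]

theorem measurableEmbedding_hyperplaneParam (n : E d) (b : ℝ) :
    MeasurableEmbedding (hyperplaneParam n b) := by
  refine Topology.IsClosedEmbedding.measurableEmbedding ?_
  exact (isometry_hyperplaneParam n b).isClosedEmbedding

/-- Cylindrical coordinates over a hyperplane, with axis in the direction `v`. -/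
def cylinderParam (n : E d) (b : ℝ) (v : E d) (p : ℝ × (ℝ ∙ n)ᗮ) : E d :=
  hyperplaneParam n b p.2 + p.1 • v

theorem measurePreserving_cylinderParam_normal {n : E d} (hn : ‖n‖ = 1) :
    MeasurePreserving (cylinderParam n 0 n) (volume.prod volume) volume := by
  have h0 := (LinearIsometryEquiv.toSpanUnitSingleton n hn).measurePreserving
  have h1 := h0.prod (MeasurePreserving.id (volume : Measure (ℝ ∙ n)ᗮ))
  have h2 := (Submodule.measurePreserving_measurableEquivProd (ℝ ∙ n) (0 : E d)).symm
  rw [InnerProductSpace.euclideanHausdorffMeasure_eq_volume] at h2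
  have h3 : cylinderParam n 0 n = ((ℝ ∙ n).measurableEquivProd (0 : E d)).symm ∘
      Prod.map (LinearIsometryEquiv.toSpanUnitSingleton n hn) (id : (ℝ ∙ n)ᗮ → (ℝ ∙ n)ᗮ) := by
    ext1 p
    simp [cylinderParam, hyperplaneParam, add_comm]
  rw [h3]
  exact h2.comp h1

theorem continuous_cylinderParam (n : E d) (b : ℝ) (v : E d) :
    Continuous (cylinderParam n b v) := by
  unfold cylinderParam hyperplaneParam
  fun_prop

/-- With `c = ⟨n, v⟩`, the vector `t • v` has normal coordinate `c t` and tangential part `t • (v -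
c • n)`. The map is thus a scaling of the first coordinate by `c`, a shear along the hyperplane, the
orthogonal decomposition and a translation; only the scaling changes volume. -/
theorem map_cylinderParam {n : E d} (hn : ‖n‖ = 1) (b : ℝ) {v : E d} (hv : inner ℝ n v ≠ 0) :
    Measure.map (cylinderParam n b v) (volume.prod volume)
      = ENNReal.ofReal |(inner ℝ n v)⁻¹| • volume := by
  set c : ℝ := inner ℝ n v with hc
  have hmem : v - c • n ∈ (ℝ ∙ n)ᗮ := by
    rw [Submodule.mem_orthogonal_singleton_iff_inner_right]
    simp [inner_sub_right, inner_smul_right, hn, hc]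
  let v' : (ℝ ∙ n)ᗮ := ⟨v - c • n, hmem⟩
  have hscale : Measure.map (Prod.map (c * ·) (id : (ℝ ∙ n)ᗮ → (ℝ ∙ n)ᗮ)) (volume.prod volume)
      = ENNReal.ofReal |c⁻¹| • (volume.prod volume) := by
    rw [← Measure.map_prod_map _ _ (measurable_const_mul c) measurable_id,
      Real.map_volume_mul_left hv, Measure.map_id, Measure.prod_smul_left]
  have hshear : MeasurePreserving (fun p : ℝ × (ℝ ∙ n)ᗮ => (p.1, (p.1 / c) • v' + p.2))
      (volume.prod volume) (volume.prod volume) := by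
    refine (MeasurePreserving.id volume).skew_product (g := fun t w => (t / c) • v' + w) ?_ ?_
    · simp only [Function.uncurry_def]
      fun_prop
    · exact Filter.Eventually.of_forall fun t => (measurePreserving_add_left volume _).map_eq
  have htrans : MeasurePreserving (fun x : E d => b • n + x) :=
    measurePreserving_add_left volume _
  have hcomp : MeasurePreserving
      ((fun x : E d => b • n + x) ∘ cylinderParam n 0 n ∘
        fun p : ℝ × (ℝ ∙ n)ᗮ => (p.1, (p.1 / c) • v' + p.2)) (volume.prod volume) volume :=
    htrans.comp ((measurePreserving_cylinderParam_normal hn).comp hshear)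
  have heq : cylinderParam n b v = ((fun x : E d => b • n + x) ∘ cylinderParam n 0 n ∘
        fun p : ℝ × (ℝ ∙ n)ᗮ => (p.1, (p.1 / c) • v' + p.2)) ∘
        Prod.map (c * ·) (id : (ℝ ∙ n)ᗮ → (ℝ ∙ n)ᗮ) := by
    ext1 p
    simp only [cylinderParam, hyperplaneParam, Function.comp_apply, Prod.map, id_eq, v',
      Submodule.coe_add, Submodule.coe_smul, mul_div_cancel_left₀ _ hv, zero_smul, zero_add,
      smul_sub]
    rw [smul_smul, mul_comm c]
    abel
  rw [heq, ← Measure.map_map hcomp.measurable (by fun_prop), hscale, Measure.map_smul,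
    hcomp.map_eq]

/-- The signed time at which the line `t ↦ x + t v` hits the hyperplane `n · x = b`. -/
def hitTime (n : E d) (b : ℝ) (v x : E d) : ℝ := (b - inner ℝ n x) / inner ℝ n v

/-- The points from which the ray in direction `v` hits the part `A` of the hyperplane
`n · x = b`. -/
def shadow (n : E d) (b : ℝ) (v : E d) (A : Set (E d)) : Set (E d) :=
  {x | 0 ≤ hitTime n b v x ∧ x + hitTime n b v x • v ∈ A}

theorem continuous_hitTime (n : E d) (b : ℝ) (v : E d) : Continuous (hitTime n b v) := by
  unfold hitTime
  fun_prop

theorem measurableSet_shadow (n : E d) (b : ℝ) (v : E d) {A : Set (E d)} (hA : MeasurableSet A) :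
    MeasurableSet (shadow n b v A) := by
  have h := (continuous_hitTime n b v).measurable
  refine (measurableSet_le measurable_const h).inter ?_
  exact (measurable_id.add (h.smul_const v)) hA

theorem hitTime_add_smul {n : E d} {b : ℝ} {v x : E d} (hv : inner ℝ n v ≠ 0)
    (hx : inner ℝ n x = b) (t : ℝ) : hitTime n b v (x + t • v) = -t := by
  simp only [hitTime, inner_add_right, inner_smul_right, hx]
  field_simp
  ring

/-- Fubini in oblique cylindrical coordinates, where the shadow is the product of the half-line `t ≤
0` with `A`. The factor `|⟨n, v⟩|` is the Jacobian. -/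
theorem integral_shadow {n : E d} (hn : ‖n‖ = 1) (b : ℝ) {v : E d} (hv : inner ℝ n v ≠ 0)
    {A : Set (E d)} (hA : MeasurableSet A) (hAb : A ⊆ {x | inner ℝ n x = b}) {g : E d → ℝ}
    (hg : Integrable g) :
    |inner ℝ n v| * ∫ y in A, (∫ t in Set.Iic (0 : ℝ), g (y + t • v)) ∂(surfaceMeasure d)
      = ∫ x, (shadow n b v A).indicator g x := by
  have hmap := map_cylinderParam hn b hv
  have hcont := (continuous_cylinderParam n b v).measurable
  have hpre : cylinderParam n b v ⁻¹' shadow n b v A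
      = Set.Iic 0 ×ˢ (hyperplaneParam n b ⁻¹' A) := by
    ext ⟨t, w⟩
    have hw : inner ℝ n (hyperplaneParam n b w) = b := by
      have : hyperplaneParam n b w ∈ Set.range (hyperplaneParam n b) := ⟨w, rfl⟩
      rwa [range_hyperplaneParam hn b] at this
    simp only [Set.mem_preimage, shadow, cylinderParam, Set.mem_ofPred_eq, Set.mem_prod, Set.mem_Iic,
      hitTime_add_smul hv hw]
    constructor
    · rintro ⟨h1, h2⟩
      exact ⟨by linarith, by simpa using h2⟩
    · rintro ⟨h1, h2⟩
      exact ⟨by linarith, by simpa using h2⟩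
  have hgi : Integrable (fun p => g (cylinderParam n b v p)) (volume.prod volume) := by
    have : Integrable g (Measure.map (cylinderParam n b v) (volume.prod volume)) := by
      rw [hmap]
      exact hg.smul_measure ENNReal.ofReal_ne_top
    exact this.comp_measurable hcont
  have hS := measurableSet_shadow n b v hA
  have h1 : ∫ p, (shadow n b v A).indicator g (cylinderParam n b v p) ∂(volume.prod volume)
      = |(inner ℝ n v)⁻¹| * ∫ x, (shadow n b v A).indicator g x := by
    rw [← integral_map (φ := cylinderParam n b v) hcont.aemeasurable, hmap, integral_smul_measure,
      ENNReal.toReal_ofReal (abs_nonneg _), smul_eq_mul]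
    rw [hmap]
    exact (hg.indicator hS).aestronglyMeasurable.smul_measure _
  have h2 : ∫ p, (shadow n b v A).indicator g (cylinderParam n b v p) ∂(volume.prod volume)
      = ∫ y in A, (∫ t in Set.Iic (0 : ℝ), g (y + t • v)) ∂(surfaceMeasure d) := by
    have hmeas : MeasurableSet (hyperplaneParam n b ⁻¹' A) :=
      (measurableEmbedding_hyperplaneParam n b).measurable hA
    have hind : (fun p => (shadow n b v A).indicator g (cylinderParam n b v p))
        = (Set.Iic (0 : ℝ) ×ˢ (hyperplaneParam n b ⁻¹' A)).indicator
          (fun p => g (cylinderParam n b v p)) := by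
      rw [← hpre]
      rfl
    rw [hind, integral_indicator (measurableSet_Iic.prod hmeas), ← Measure.prod_restrict,
      integral_prod_symm]
    · have hr : (surfaceMeasure d).restrict A
          = Measure.map (hyperplaneParam n b) (volume.restrict (hyperplaneParam n b ⁻¹' A)) := by
        rw [← Measure.restrict_map (measurableEmbedding_hyperplaneParam n b).measurable hA,
          map_hyperplaneParam hn, Measure.restrict_restrict_of_subset hAb]
      rw [hr, (measurableEmbedding_hyperplaneParam n b).integral_map]
      rfl
    · rw [Measure.prod_restrict]
      exact hgi.integrableOn
  rw [← h2, h1, abs_inv, ← mul_assoc, mul_inv_cancel₀ (abs_ne_zero.2 hv), one_mul]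

theorem surfaceMeasure_lt_top_of_isBounded {n : E d} (hn : ‖n‖ = 1) {b : ℝ} {A : Set (E d)}
    (hA : MeasurableSet A) (hAb : A ⊆ {x | inner ℝ n x = b}) (hbdd : Bornology.IsBounded A) :
    surfaceMeasure d A < ⊤ := by
  rw [← Set.inter_eq_left.2 hAb, ← Measure.restrict_apply hA, ← map_hyperplaneParam hn,
    Measure.map_apply (measurableEmbedding_hyperplaneParam n b).measurable hA]
  exact ((isometry_hyperplaneParam n b).antilipschitz.isBounded_preimage hbdd).measure_lt_top

theorem volume_hyperplane_eq_zero {n : E d} (hn : n ≠ 0) (b : ℝ) :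
    volume {x : E d | inner ℝ n x = b} = 0 := by
  by_cases hne : ∃ x₀ : E d, inner ℝ n x₀ = b
  · obtain ⟨x₀, hx₀⟩ := hne
    have h : {x : E d | inner ℝ n x = b} = (fun x => x - x₀) ⁻¹' ((ℝ ∙ n)ᗮ : Submodule ℝ (E d)) := by
      ext x
      simp [Submodule.mem_orthogonal_singleton_iff_inner_right, inner_sub_right, hx₀, sub_eq_zero]
    rw [h, (measurePreserving_sub_right volume x₀).measure_preimage
      (Submodule.closed_of_finiteDimensional _).measurableSet.nullMeasurableSet]
    refine Measure.addHaar_submodule _ _ fun htop => hn ?_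
    have : n ∈ (ℝ ∙ n)ᗮ := htop ▸ Submodule.mem_top
    rw [Submodule.mem_orthogonal_singleton_iff_inner_right] at this
    exact inner_self_eq_zero.1 this
  · have h : {x : E d | inner ℝ n x = b} = ∅ := by
      ext x
      exact ⟨fun hx => hne ⟨x, hx⟩, fun hx => hx.elim⟩
    simp [h]

end Hyperplane

/-! ### The divergence theorem on convex polytopes -/

section Polytope

variable {d : ℕ}

theorem ConvexPolytope.facet_subset_carrier (K : ConvexPolytope d) (s : E d × ℝ) :
    K.facet s ⊆ K.carrier := fun _ hx => hx.1

theorem ConvexPolytope.facet_subset_hyperplane (K : ConvexPolytope d) (s : E d × ℝ) :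
    K.facet s ⊆ {x | inner ℝ s.1 x = s.2} := fun _ hx => hx.2

theorem ConvexPolytope.isCompact_facet (K : ConvexPolytope d) (s : E d × ℝ) :
    IsCompact (K.facet s) :=
  K.isCompact_carrier.inter_right (isClosed_eq (by fun_prop) continuous_const)

theorem ConvexPolytope.measurableSet_facet (K : ConvexPolytope d) (s : E d × ℝ) :
    MeasurableSet (K.facet s) := (K.isCompact_facet s).isClosed.measurableSet

theorem ConvexPolytope.measurableSet_carrier (K : ConvexPolytope d) :
    MeasurableSet K.carrier := K.isCompact_carrier.isClosed.measurableSet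

theorem ConvexPolytope.surfaceMeasure_facet_lt_top (K : ConvexPolytope d) {s : E d × ℝ}
    (hs : s ∈ K.halfspaces) : surfaceMeasure d (K.facet s) < ⊤ :=
  surfaceMeasure_lt_top_of_isBounded (K.norm_normal s hs) (K.measurableSet_facet s)
    (K.facet_subset_hyperplane s) (K.isCompact_facet s).isBounded

theorem ConvexPolytope.convex_carrier (K : ConvexPolytope d) : Convex ℝ K.carrier := by
  have h : K.carrier = ⋂ s ∈ K.halfspaces, {x : E d | inner ℝ s.1 x ≤ s.2} := by
    ext x
    simp [ConvexPolytope.carrier]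
  rw [h]
  refine convex_iInter₂ fun s _ => ?_
  exact convex_halfSpace_le (innerₛₗ ℝ s.1).isLinear _

theorem inner_add_hitTime {n : E d} {b : ℝ} {v x : E d} (hv : inner ℝ n v ≠ 0) :
    inner ℝ n (x + hitTime n b v x • v) = b := by
  simp only [hitTime, inner_add_right, inner_smul_right]
  field_simp
  ring

theorem hitTime_neg (n : E d) (b : ℝ) (v x : E d) : hitTime n b (-v) x = -hitTime n b v x := by
  simp [hitTime, div_neg]

/-- Moving along `v` increases `⟨s.1, ·⟩`, so the line cannot return to the half-space after the
hit. Exit times are therefore minimal hit times. -/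
theorem ConvexPolytope.le_hitTime {K : ConvexPolytope d} {s : E d × ℝ} (hs : s ∈ K.halfspaces)
    {v x : E d} (hv : 0 < inner ℝ s.1 v) {t : ℝ} (ht : x + t • v ∈ K.carrier) :
    t ≤ hitTime s.1 s.2 v x := by
  have h := ht s hs
  rw [inner_add_right, inner_smul_right] at h
  rw [hitTime, le_div_iff₀ hv]
  linarith

/-- A line that meets the polytope leaves it through some facet. -/
theorem ConvexPolytope.exists_exit (K : ConvexPolytope d) {v : E d} (hv0 : v ≠ 0) {x : E d} {t₀ : ℝ}
    (ht₀ : x + t₀ • v ∈ K.carrier) :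
    ∃ s ∈ K.halfspaces, 0 < inner ℝ s.1 v ∧ x + hitTime s.1 s.2 v x • v ∈ K.carrier := by
  classical
  set S := K.halfspaces.filter fun s => 0 < inner ℝ s.1 v with hS
  -- If no outward normal had positive component along `v`, the whole forward ray would remain in
  -- the bounded polytope.
  have hne : S.Nonempty := by
    by_contra hemp
    have hle : ∀ s ∈ K.halfspaces, inner ℝ s.1 v ≤ 0 := by
      intro s hs
      by_contra hpos
      exact hemp ⟨s, Finset.mem_filter.2 ⟨hs, not_le.1 hpos⟩⟩
    obtain ⟨C, hC⟩ := K.isCompact_carrier.isBounded.exists_norm_le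
    have hmem : ∀ t, t₀ ≤ t → x + t • v ∈ K.carrier := by
      intro t ht s hs
      have h := ht₀ s hs
      rw [inner_add_right, inner_smul_right] at h ⊢
      nlinarith [hle s hs]
    have hvpos : 0 < ‖v‖ := norm_pos_iff.2 hv0
    -- This time makes `t * ‖v‖` at least `C + ‖x‖ + 1`, so the point has norm greater than the
    -- bound `C`.
    set t := max t₀ ((C + ‖x‖ + 1) / ‖v‖) with ht
    have h1 := hC _ (hmem t (le_max_left _ _))
    have h2 : C + ‖x‖ + 1 ≤ t * ‖v‖ := (div_le_iff₀ hvpos).1 (le_max_right _ _)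
    have h3 : ‖t • v‖ ≤ ‖x + t • v‖ + ‖x‖ := by
      simpa using norm_sub_le (x + t • v) x
    rw [norm_smul, Real.norm_eq_abs] at h3
    nlinarith [le_abs_self t]
  obtain ⟨s, hs, hmin⟩ := S.exists_min_image (fun s => hitTime s.1 s.2 v x) hne
  obtain ⟨hsK, hspos⟩ := Finset.mem_filter.1 hs
  refine ⟨s, hsK, hspos, fun s' hs' => ?_⟩
  by_cases hpos : 0 < inner ℝ s'.1 v
  · have h := hmin s' (Finset.mem_filter.2 ⟨hs', hpos⟩)
    have h' := inner_add_hitTime (b := s'.2) (x := x) hpos.ne'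
    rw [inner_add_right, inner_smul_right] at h' ⊢
    nlinarith
  · have h := K.le_hitTime hsK hspos ht₀
    have h' := ht₀ s' hs'
    rw [inner_add_right, inner_smul_right] at h' ⊢
    nlinarith

theorem ae_inner_ne {n : E d} (hn : n ≠ 0) (b : ℝ) : ∀ᵐ x : E d, inner ℝ n x ≠ b := by
  rw [ae_iff]
  simpa using volume_hyperplane_eq_zero hn b

/-- Equal hit times amount to one affine equation in `x`, with coefficient vector `c' • s.1 - c •
s'.1`. If this vector is nonzero the solutions form a null hyperplane; if it is zero, unit length
forces equal normals, and a solution then forces equal offsets. -/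
theorem ae_hitTime_ne {s s' : E d × ℝ} (hs : ‖s.1‖ = 1) (hs' : ‖s'.1‖ = 1) (hne : s ≠ s') {v : E d}
    (h : 0 < inner ℝ s.1 v) (h' : 0 < inner ℝ s'.1 v) :
    ∀ᵐ x : E d, hitTime s.1 s.2 v x ≠ hitTime s'.1 s'.2 v x := by
  set c : ℝ := inner ℝ s.1 v
  set c' : ℝ := inner ℝ s'.1 v
  have key : ∀ x, hitTime s.1 s.2 v x = hitTime s'.1 s'.2 v x →
      inner ℝ (c' • s.1 - c • s'.1) x = c' * s.2 - c * s'.2 := by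
    intro x hx
    simp only [hitTime] at hx
    rw [div_eq_div_iff h.ne' h'.ne'] at hx
    rw [inner_sub_left, real_inner_smul_left, real_inner_smul_left]
    linear_combination -hx
  by_cases h0 : c' • s.1 - c • s'.1 = 0
  · refine Filter.Eventually.of_forall fun x hx => hne ?_
    have h1 := key x hx
    have h2 : c' = c := by
      have := congrArg norm (sub_eq_zero.1 h0)
      rwa [norm_smul, norm_smul, hs, hs', mul_one, mul_one, Real.norm_of_nonneg h.le,
        Real.norm_of_nonneg h'.le] at this
    rw [h0, inner_zero_left, h2] at h1
    rw [h2, ← smul_sub, smul_eq_zero, sub_eq_zero] at h0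
    have h3 : s.2 = s'.2 := by
      have : c * (s.2 - s'.2) = 0 := by linarith
      rcases mul_eq_zero.1 this with h4 | h4
      · exact absurd h4 h.ne'
      · linarith
    exact Prod.ext (h0.resolve_left h.ne') h3
  · filter_upwards [ae_inner_ne h0 (c' * s.2 - c * s'.2)] with x hx heq using hx (key x heq)

theorem ConvexPolytope.ae_hitTime_injOn (K : ConvexPolytope d) (v : E d) :
    ∀ᵐ x : E d, ∀ s ∈ K.halfspaces, ∀ s' ∈ K.halfspaces, 0 < inner ℝ s.1 v → 0 < inner ℝ s'.1 v →
      hitTime s.1 s.2 v x = hitTime s'.1 s'.2 v x → s = s' := by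
  have : ∀ s : K.halfspaces, ∀ s' : K.halfspaces, ∀ᵐ x : E d,
      0 < inner ℝ s.1.1 v → 0 < inner ℝ s'.1.1 v →
      hitTime s.1.1 s.1.2 v x = hitTime s'.1.1 s'.1.2 v x → s = s' := by
    intro s s'
    by_cases hne : s = s'
    · exact Filter.Eventually.of_forall fun x _ _ _ => hne
    by_cases h : 0 < inner ℝ s.1.1 v
    · by_cases h' : 0 < inner ℝ s'.1.1 v
      · filter_upwards [ae_hitTime_ne (K.norm_normal _ s.2) (K.norm_normal _ s'.2)
          (fun h => hne (Subtype.ext h)) h h'] with x hx _ _ heq using absurd heq hx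
      · exact Filter.Eventually.of_forall fun x _ h2 => absurd h2 h'
    · exact Filter.Eventually.of_forall fun x h1 => absurd h1 h
  have h2 := ae_all_iff.2 fun s => ae_all_iff.2 (this s)
  filter_upwards [h2] with x hx s hs s' hs' h h' heq
  exact congrArg Subtype.val (hx ⟨s, hs⟩ ⟨s', hs'⟩ h h' heq)

/-- Almost every line that meets the polytope leaves it through exactly one facet. -/
theorem ConvexPolytope.ae_exists_unique_exit (K : ConvexPolytope d) {v : E d} (hv0 : v ≠ 0) :
    ∀ᵐ x : E d, ∀ t₀ : ℝ, x + t₀ • v ∈ K.carrier →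
      ∃ s ∈ K.halfspaces, 0 < inner ℝ s.1 v ∧ x + hitTime s.1 s.2 v x • v ∈ K.carrier ∧
        ∀ s' ∈ K.halfspaces, 0 < inner ℝ s'.1 v → x + hitTime s'.1 s'.2 v x • v ∈ K.carrier →
          s' = s := by
  filter_upwards [K.ae_hitTime_injOn v] with x hx t₀ ht₀
  obtain ⟨s, hs, hpos, hmem⟩ := K.exists_exit hv0 ht₀
  refine ⟨s, hs, hpos, hmem, fun s' hs' hpos' hmem' => hx s' hs' s hs hpos' hpos ?_⟩
  -- Both hit points lie in the polytope, so each hit time bounds the other.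
  exact le_antisymm (K.le_hitTime hs hpos hmem') (K.le_hitTime hs' hpos' hmem)

/-- Counting the facets hit by the ray from `x` in direction `v`, with the sign of the crossing,
detects whether `x` belongs to the polytope. -/
theorem ConvexPolytope.ae_sum_sign_indicator_shadow (K : ConvexPolytope d) {v : E d}
    (hv0 : v ≠ 0) (a : E d → ℝ) :
    ∀ᵐ x : E d, ∑ s ∈ K.halfspaces, Real.sign (inner ℝ s.1 v) *
      (shadow s.1 s.2 v (K.facet s)).indicator a x = K.carrier.indicator a x := by
  classical
  have hbd : ∀ᵐ x : E d, ∀ s : K.halfspaces, inner ℝ s.1.1 x ≠ s.1.2 := by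
    refine ae_all_iff.2 fun s => ae_inner_ne ?_ _
    intro h0
    have := K.norm_normal _ s.2
    simp [h0] at this
  filter_upwards [hbd, K.ae_exists_unique_exit hv0, K.ae_exists_unique_exit (neg_ne_zero.2 hv0)]
    with x hx hexit hentry
  have hshadow : ∀ s : E d × ℝ, inner ℝ s.1 v ≠ 0 → (x ∈ shadow s.1 s.2 v (K.facet s) ↔
      0 ≤ hitTime s.1 s.2 v x ∧ x + hitTime s.1 s.2 v x • v ∈ K.carrier) := by
    intro s hs
    simp only [shadow, ConvexPolytope.facet, Set.mem_ofPred_eq, inner_add_hitTime hs, and_true]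
  by_cases hmeet : ∃ t₀ : ℝ, x + t₀ • v ∈ K.carrier
  swap
  · have hxK : x ∉ K.carrier := fun h => hmeet ⟨0, by simpa using h⟩
    rw [Set.indicator_of_notMem hxK]
    refine Finset.sum_eq_zero fun s _ => ?_
    by_cases h0 : inner ℝ s.1 v = 0
    · simp [h0]
    · rw [Set.indicator_of_notMem, mul_zero]
      rw [hshadow s h0]
      exact fun h => hmeet ⟨_, h.2⟩
  obtain ⟨t₀, ht₀⟩ := hmeet
  obtain ⟨p, hp, hppos, hpK, hpuniq⟩ := hexit t₀ ht₀
  -- The entry facet for `v` is the exit facet for `-v`.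
  obtain ⟨m, hm, hmpos, hmK, hmuniq⟩ := hentry (-t₀) (by simpa using ht₀)
  simp only [hitTime_neg, neg_smul, smul_neg, neg_neg, inner_neg_right] at hmpos hmK hmuniq
  have hmneg : inner ℝ m.1 v < 0 := by linarith
  have hle : hitTime m.1 m.2 v x ≤ hitTime p.1 p.2 v x := K.le_hitTime hp hppos hmK
  -- Shadows include hit time zero, so a point on the entry facet would be miscounted; such points
  -- were excluded as null.
  have hne : hitTime m.1 m.2 v x ≠ 0 := by
    intro h0
    have := inner_add_hitTime (b := m.2) (x := x) hmneg.ne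
    rw [h0, zero_smul, add_zero] at this
    exact hx ⟨m, hm⟩ this
  -- By convexity, the line is in the polytope exactly between the entry and exit times, and `x`
  -- sits at time zero.
  have hxK : x ∈ K.carrier ↔ hitTime m.1 m.2 v x ≤ 0 ∧ 0 ≤ hitTime p.1 p.2 v x := by
    constructor
    · intro h
      refine ⟨?_, K.le_hitTime hp hppos (by simpa using h)⟩
      have := K.le_hitTime (v := -v) (x := x) (t := 0) hm (by simpa using hmneg) (by simpa using h)
      rw [hitTime_neg] at this
      linarith
    · rintro ⟨h1, h2⟩ s hs
      have e1 := hmK s hs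
      have e2 := hpK s hs
      rw [inner_add_right, inner_smul_right] at e1 e2
      by_cases h0 : 0 ≤ inner ℝ s.1 v <;> nlinarith
  have hterm : ∀ s ∈ K.halfspaces, Real.sign (inner ℝ s.1 v) *
      (shadow s.1 s.2 v (K.facet s)).indicator a x
      = (if s = p then (if 0 ≤ hitTime s.1 s.2 v x then a x else 0) else 0)
        - (if s = m then (if 0 ≤ hitTime s.1 s.2 v x then a x else 0) else 0) := by
    intro s hs
    rcases lt_trichotomy (inner ℝ s.1 v) 0 with h | h | h
    · have hsp : s ≠ p := by rintro rfl; linarith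
      rw [if_neg hsp, Real.sign_of_neg h, Set.indicator_apply, hshadow s h.ne]
      by_cases hsm : s = m
      · subst hsm
        by_cases h2 : 0 ≤ hitTime s.1 s.2 v x <;> simp [hmK, h2]
      · have : x + hitTime s.1 s.2 v x • v ∉ K.carrier :=
          fun hK => hsm (hmuniq s hs (by linarith) hK)
        simp [hsm, this]
    · have hsp : s ≠ p := by rintro rfl; linarith
      have hsm : s ≠ m := by rintro rfl; linarith
      simp [h, hsp, hsm]
    · have hsm : s ≠ m := by rintro rfl; linarith
      rw [if_neg hsm, Real.sign_of_pos h, Set.indicator_apply, hshadow s h.ne']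
      by_cases hsp : s = p
      · subst hsp
        simp [hpK]
      · have : x + hitTime s.1 s.2 v x • v ∉ K.carrier :=
          fun hK => hsp (hpuniq s hs h hK)
        simp [hsp, this]
  rw [Finset.sum_congr rfl hterm, Finset.sum_sub_distrib, Finset.sum_ite_eq' _ p,
    Finset.sum_ite_eq' _ m, if_pos hp, if_pos hm, Set.indicator_apply]
  -- When the entry lies behind `x`, only the exit can be counted; when it lies ahead, so does the
  -- exit, and the two signs cancel.
  by_cases h1 : hitTime m.1 m.2 v x ≤ 0
  · have h1' : ¬ 0 ≤ hitTime m.1 m.2 v x := fun h => hne (le_antisymm h1 h)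
    simp [hxK, h1, h1']
  · have h2 : 0 ≤ hitTime m.1 m.2 v x := (not_le.1 h1).le
    simp [hxK, h1, h2, h2.trans hle]

end Polytope

/-! ### From line derivatives along rays to the divergence theorem -/

section Divergence

variable {d : ℕ}

theorem deriv_comp_line (f : E d → ℝ) (y v : E d) (t : ℝ) :
    deriv (fun t : ℝ => f (y + t • v)) t = lineDeriv ℝ f (y + t • v) v := by
  rw [lineDeriv]
  have h : (fun s : ℝ => f (y + t • v + s • v)) = fun s => (fun t : ℝ => f (y + t • v)) (t + s) := by
    ext s
    simp only [add_smul, add_assoc]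
  rw [h, deriv_comp_const_add (fun t : ℝ => f (y + t • v)), add_zero]

/-- A Lipschitz function is absolutely continuous on lines, so the fundamental theorem of calculus
applies. Compact support reduces the half-line to a bounded interval. -/
theorem integral_Iic_lineDeriv {f : E d → ℝ} {C : NNReal} (hf : LipschitzWith C f)
    (hsupp : HasCompactSupport f) {v : E d} (hv : v ≠ 0) (y : E d) :
    ∫ t in Set.Iic (0 : ℝ), lineDeriv ℝ f (y + t • v) v = f y := by
  have hL : LipschitzWith (C * ‖v‖₊) (fun t : ℝ => f (y + t • v)) := by
    refine hf.comp (LipschitzWith.of_dist_le_mul fun s t => ?_)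
    rw [dist_add_left, dist_eq_norm, ← sub_smul, norm_smul, mul_comm, Real.dist_eq,
      Real.norm_eq_abs]
    rfl
  obtain ⟨R, hR⟩ := hsupp.isBounded.exists_norm_le
  have hvpos : 0 < ‖v‖ := norm_pos_iff.2 hv
  -- For `|t| ≥ M` the point `y + t • v` has norm at least `|R| + 1`, beyond the support.
  set M : ℝ := (|R| + ‖y‖ + 1) / ‖v‖ with hM
  have hMpos : 0 < M := by positivity
  have hzero : ∀ t, t ≤ -M → y + t • v ∉ tsupport f := by
    intro t ht hmem
    have h1 := hR _ hmem
    have h2 : ‖t • v‖ ≤ ‖y + t • v‖ + ‖y‖ := by simpa using norm_sub_le (y + t • v) y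
    rw [norm_smul, Real.norm_eq_abs] at h2
    have h3 : |R| + ‖y‖ + 1 = M * ‖v‖ := by rw [hM]; field_simp
    have h4 : M ≤ |t| := by
      rw [abs_of_nonpos (by linarith)]
      linarith
    nlinarith [le_abs_self R]
  have hsub : Set.Ioc (-M) 0 ⊆ Set.Iic 0 := fun t ht => ht.2
  rw [setIntegral_eq_of_subset_of_forall_sdiff_eq_zero measurableSet_Iic hsub,
    ← intervalIntegral.integral_of_le (by linarith)]
  · simp_rw [← deriv_comp_line]
    rw [(hL.lipschitzOnWith (s := Set.uIcc (-M) 0)).absolutelyContinuousOnInterval.integral_deriv_eq_sub,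
      image_eq_zero_of_notMem_tsupport (hzero (-M) le_rfl)]
    simp
  · rintro t ⟨ht1, ht2⟩
    have ht : t ≤ -M := by
      by_contra h
      exact ht2 ⟨not_le.1 h, ht1⟩
    have hev : f =ᶠ[nhds (y + t • v)] fun _ => 0 := by
      filter_upwards [(isClosed_tsupport f).isOpen_compl.mem_nhds (hzero t ht)] with x hx
      exact image_eq_zero_of_notMem_tsupport hx
    rw [hev.lineDeriv_eq]
    simp [lineDeriv]

theorem integrable_lineDeriv {f : E d → ℝ} {C : NNReal} (hf : LipschitzWith C f)
    (hsupp : HasCompactSupport f) (v : E d) : Integrable (fun x => lineDeriv ℝ f x v) := by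
  have hsub : Function.support (fun x => lineDeriv ℝ f x v) ⊆ tsupport f := by
    intro x hx
    by_contra h
    have hev : f =ᶠ[nhds x] fun _ => 0 := by
      filter_upwards [(isClosed_tsupport f).isOpen_compl.mem_nhds h] with x hx
      exact image_eq_zero_of_notMem_tsupport hx
    apply hx
    change lineDeriv ℝ f x v = 0
    rw [hev.lineDeriv_eq]
    simp [lineDeriv]
  rw [← integrableOn_iff_integrable_of_support_subset hsub]
  refine Measure.integrableOn_of_bounded (M := C * ‖v‖) hsupp.isCompact.measure_lt_top.ne
    (measurable_lineDeriv hf.continuous).aestronglyMeasurable ?_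
  exact Filter.Eventually.of_forall fun x => norm_lineDeriv_le_of_lipschitz ℝ hf

/-- Replacing `f` on each facet by its ray integral turns the facet term into a signed integral of
the line derivative over the facet's shadow. Facets parallel to `v` contribute nothing on either
side. -/
theorem ConvexPolytope.setIntegral_lineDeriv (K : ConvexPolytope d) {f : E d → ℝ} {C : NNReal}
    (hf : LipschitzWith C f) (hsupp : HasCompactSupport f) (v : E d) :
    ∫ x in K.carrier, lineDeriv ℝ f x v
      = ∑ s ∈ K.halfspaces, inner ℝ s.1 v * ∫ x in K.facet s, f x ∂(surfaceMeasure d) := by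
  by_cases hv : v = 0
  · simp [hv, lineDeriv_zero]
  have hint := integrable_lineDeriv hf hsupp v
  have hterm : ∀ s ∈ K.halfspaces, Real.sign (inner ℝ s.1 v) *
      ∫ x, (shadow s.1 s.2 v (K.facet s)).indicator (fun x => lineDeriv ℝ f x v) x
      = inner ℝ s.1 v * ∫ x in K.facet s, f x ∂(surfaceMeasure d) := by
    intro s hs
    by_cases h0 : inner ℝ s.1 v = 0
    · simp [h0]
    · rw [← integral_shadow (K.norm_normal s hs) s.2 h0 (K.measurableSet_facet s)
        (K.facet_subset_hyperplane s) hint, ← mul_assoc]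
      simp_rw [integral_Iic_lineDeriv hf hsupp hv]
      congr 1
      rcases lt_or_gt_of_ne h0 with h | h
      · rw [Real.sign_of_neg h, abs_of_neg h]; ring
      · rw [Real.sign_of_pos h, abs_of_pos h]; ring
  rw [← Finset.sum_congr rfl hterm, ← integral_indicator K.measurableSet_carrier]
  simp_rw [← integral_const_mul]
  rw [← integral_finsetSum]
  · refine integral_congr_ae ?_
    filter_upwards [K.ae_sum_sign_indicator_shadow hv (fun x => lineDeriv ℝ f x v)] with x hx
    exact hx.symm
  · intro s hs
    exact (hint.indicator (measurableSet_shadow _ _ _ (K.measurableSet_facet s))).const_mul _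

/-- Prescribing zero outside a ball of radius `R + 1` keeps the function Lipschitz: the gap to `S`
has width at least one and `F` is bounded on `S`. A Lipschitz extension across the gap then has
compact support. -/
theorem exists_lipschitzWith_hasCompactSupport_eqOn {F : E d → ℝ} {C : NNReal} {S : Set (E d)}
    (hS : IsCompact S) (hF : LipschitzOnWith C F S) :
    ∃ (C' : NNReal) (f : E d → ℝ), LipschitzWith C' f ∧ HasCompactSupport f ∧ Set.EqOn F f S := by
  classical
  obtain ⟨R, hR⟩ := hS.isBounded.exists_norm_le
  obtain ⟨M, hM⟩ := hS.exists_bound_of_continuousOn hF.continuousOn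
  set G : E d → ℝ := fun x => if x ∈ S then F x else 0 with hG
  set U : Set (E d) := S ∪ {x | R + 1 ≤ ‖x‖} with hU
  have hmix : ∀ x ∈ S, ∀ y ∉ S, R + 1 ≤ ‖y‖ →
      dist (G x) (G y) ≤ (max C M.toNNReal : NNReal) * dist x y := by
    intro x hx y hy hy'
    have h1 : ‖F x‖ ≤ M.toNNReal := (hM x hx).trans (Real.le_coe_toNNReal M)
    have h2 : 1 ≤ dist x y := by
      have := norm_sub_norm_le y x
      rw [dist_comm, dist_eq_norm]
      linarith [hR x hx]
    simp only [hG, hx, hy, if_true, if_false, dist_zero_right]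
    calc ‖F x‖ ≤ (max C M.toNNReal : NNReal) * 1 := by
          rw [mul_one]
          exact h1.trans (by exact_mod_cast le_max_right _ _)
      _ ≤ _ := by gcongr
  have hLip : LipschitzOnWith (max C M.toNNReal) G U := by
    refine LipschitzOnWith.of_dist_le_mul fun x hx y hy => ?_
    by_cases hxS : x ∈ S
    · by_cases hyS : y ∈ S
      · simp only [hG, hxS, hyS, if_true]
        refine (hF.dist_le_mul x hxS y hyS).trans ?_
        gcongr
        exact le_max_left _ _
      · exact hmix x hxS y hyS (hy.resolve_left hyS)
    · by_cases hyS : y ∈ S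
      · rw [dist_comm, dist_comm x]
        exact hmix y hyS x hxS (hx.resolve_left hxS)
      · simp only [hG, hxS, hyS, if_false, dist_self]
        positivity
  obtain ⟨f, hf, hfe⟩ := hLip.extend_real
  refine ⟨_, f, hf, ?_, fun x hx => ?_⟩
  · refine HasCompactSupport.intro (isCompact_closedBall (0 : E d) (R + 1)) fun x hx => ?_
    have hx' : R + 1 ≤ ‖x‖ := by
      rw [mem_closedBall_zero_iff, not_le] at hx
      exact hx.le
    rw [← hfe (Or.inr hx')]
    have : x ∉ S := fun h => by
      rw [mem_closedBall_zero_iff] at hx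
      linarith [hR x h]
    simp [hG, this]
  · rw [← hfe (Or.inl hx)]
    simp [hG, hx]

theorem ConvexPolytope.ae_mem_interior (K : ConvexPolytope d) :
    ∀ᵐ x ∂(volume.restrict K.carrier), x ∈ interior K.carrier := by
  have h := K.convex_carrier.addHaar_frontier volume
  rw [ae_restrict_iff' K.measurableSet_carrier]
  filter_upwards [measure_eq_zero_iff_ae_notMem.1 h] with x hx hxK
  by_contra hint
  exact hx ⟨subset_closure hxK, hint⟩

theorem ConvexPolytope.ae_differentiableAt (K : ConvexPolytope d) {F : E d → ℝ} {C : NNReal}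
    (hF : LipschitzOnWith C F K.carrier) :
    ∀ᵐ x ∂(volume.restrict K.carrier), DifferentiableAt ℝ F x := by
  have h := hF.ae_differentiableWithinAt (μ := volume) K.measurableSet_carrier
  filter_upwards [h, K.ae_mem_interior] with x hx hint
  exact hx.differentiableAt (mem_interior_iff_mem_nhds.1 hint)

/-- The divergence theorem for a Lipschitz function on a convex polytope. -/
theorem ConvexPolytope.setIntegral_fderiv (K : ConvexPolytope d) {F : E d → ℝ} {C : NNReal}
    (hF : LipschitzOnWith C F K.carrier) (v : E d) :
    ∫ x in K.carrier, fderiv ℝ F x v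
      = ∑ s ∈ K.halfspaces, inner ℝ s.1 v * ∫ x in K.facet s, F x ∂(surfaceMeasure d) := by
  obtain ⟨C', f, hf, hsupp, heq⟩ :=
    exists_lipschitzWith_hasCompactSupport_eqOn K.isCompact_carrier hF
  have h1 : ∫ x in K.carrier, fderiv ℝ F x v = ∫ x in K.carrier, lineDeriv ℝ f x v := by
    -- Nothing is known about `F` outside the polytope, so the derivatives are compared only at
    -- interior points; the frontier of a convex set is null.
    refine integral_congr_ae ?_
    filter_upwards [K.ae_differentiableAt hF, K.ae_mem_interior] with x hx hint
    have hev : F =ᶠ[nhds x] f :=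
      heq.eventuallyEq_of_mem (mem_interior_iff_mem_nhds.1 hint)
    rw [← hx.lineDeriv_eq_fderiv, hev.lineDeriv_eq]
  rw [h1, K.setIntegral_lineDeriv hf hsupp]
  refine Finset.sum_congr rfl fun s _ => ?_
  rw [setIntegral_congr_fun (K.measurableSet_facet s) fun x hx => heq (K.facet_subset_carrier s hx)]

end Divergence

/-! ### Polynomials as functions on Euclidean space -/

section Polynomials

variable {d : ℕ}

theorem hasFDerivAt_polyEval (p : MvPolynomial (Fin d) ℝ) (x : E d) :
    HasFDerivAt (polyEval p)
      (∑ j, polyEval (MvPolynomial.pderiv j p) x • (EuclideanSpace.proj j : E d →L[ℝ] ℝ)) x := by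
  induction p using MvPolynomial.induction_on with
  | C a =>
    have h : polyEval (MvPolynomial.C a) = fun _ : E d => a := by
      ext y
      simp [polyEval]
    rw [h]
    refine (hasFDerivAt_const a x).congr_fderiv ?_
    simp [polyEval]
  | add p q hp hq =>
    have h : polyEval (p + q) = fun y : E d => polyEval p y + polyEval q y := by
      ext y
      simp [polyEval]
    rw [h]
    refine (hp.add hq).congr_fderiv ?_
    simp [polyEval, add_smul, Finset.sum_add_distrib]
  | mul_X p i hp =>
    have h : polyEval (p * MvPolynomial.X i)
        = fun y : E d => polyEval p y * (EuclideanSpace.proj i : E d →L[ℝ] ℝ) y := by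
      ext y
      simp [polyEval]
    rw [h]
    refine (hp.mul (EuclideanSpace.proj i : E d →L[ℝ] ℝ).hasFDerivAt).congr_fderiv ?_
    ext w
    simp only [Derivation.leibniz, MvPolynomial.pderiv_X, smul_eq_mul, polyEval, map_add, map_mul,
      MvPolynomial.eval_X, add_apply, smul_apply, sum_apply, EuclideanSpace.coe_proj, add_mul,
      Finset.sum_add_distrib, Finset.mul_sum]
    congr 1
    · rw [Finset.sum_eq_single i]
      · simp
      · intro j _ hj
        simp [hj.symm]
      · simp
    · exact Finset.sum_congr rfl fun j _ => by ring

theorem fderiv_polyEval (p : MvPolynomial (Fin d) ℝ) (x : E d) (j : Fin d) :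
    fderiv ℝ (polyEval p) x (EuclideanSpace.single j 1) = polyEval (MvPolynomial.pderiv j p) x := by
  rw [(hasFDerivAt_polyEval p x).fderiv]
  simp

theorem continuous_polyEval (p : MvPolynomial (Fin d) ℝ) : Continuous (polyEval p) :=
  continuous_iff_continuousAt.2 fun x => (hasFDerivAt_polyEval p x).continuousAt

theorem contDiff_polyEval (p : MvPolynomial (Fin d) ℝ) : ContDiff ℝ 1 (polyEval p) := by
  rw [contDiff_one_iff_fderiv]
  refine ⟨fun x => (hasFDerivAt_polyEval p x).differentiableAt, ?_⟩
  have h : fderiv ℝ (polyEval p) = fun x =>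
      ∑ j, polyEval (MvPolynomial.pderiv j p) x • (EuclideanSpace.proj j : E d →L[ℝ] ℝ) :=
    funext fun x => (hasFDerivAt_polyEval p x).fderiv
  rw [h]
  exact continuous_finsetSum _ fun j _ => (continuous_polyEval _).smul continuous_const

end Polynomials

/-! ### Integration by parts on a polytope -/

section IntegrationByParts

variable {d : ℕ}

theorem lipschitzOnWith_mul {X : Type*} [PseudoMetricSpace X] {F G : X → ℝ} {S : Set X}
    (hS : IsCompact S) (hF : ∃ C, LipschitzOnWith C F S) (hG : ∃ C, LipschitzOnWith C G S) :
    ∃ C, LipschitzOnWith C (fun x => F x * G x) S := by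
  obtain ⟨C, hF⟩ := hF
  obtain ⟨C', hG⟩ := hG
  obtain ⟨M, hM⟩ := hS.exists_bound_of_continuousOn hF.continuousOn
  obtain ⟨M', hM'⟩ := hS.exists_bound_of_continuousOn hG.continuousOn
  refine ⟨M.toNNReal * C' + M'.toNNReal * C, LipschitzOnWith.of_dist_le_mul fun x hx y hy => ?_⟩
  have h1 := hF.dist_le_mul x hx y hy
  have h2 := hG.dist_le_mul x hx y hy
  rw [Real.dist_eq] at h1 h2 ⊢
  have h3 : F x * G x - F y * G y = F x * (G x - G y) + G y * (F x - F y) := by ring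
  rw [h3]
  calc |F x * (G x - G y) + G y * (F x - F y)|
      ≤ |F x| * |G x - G y| + |G y| * |F x - F y| := by
        rw [← abs_mul, ← abs_mul]
        exact abs_add_le _ _
    _ ≤ M.toNNReal * (C' * dist x y) + M'.toNNReal * (C * dist x y) := by
        gcongr
        · exact (hM x hx).trans (Real.le_coe_toNNReal M)
        · exact (hM' y hy).trans (Real.le_coe_toNNReal M')
    _ = _ := by push_cast; ring

theorem ConvexPolytope.lipschitzOnWith_polyEval (K : ConvexPolytope d)
    (p : MvPolynomial (Fin d) ℝ) : ∃ C, LipschitzOnWith C (polyEval p) K.carrier :=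
  (contDiff_polyEval p).contDiffOn.exists_lipschitzOnWith one_ne_zero K.convex_carrier
    K.isCompact_carrier

theorem lipschitzOnWith_apply {B : E d → E d} {S : Set (E d)} (hB : ∃ C, LipschitzOnWith C B S)
    (j : Fin d) : ∃ C, LipschitzOnWith C (fun x => B x j) S := by
  obtain ⟨C, hB⟩ := hB
  exact ⟨_, (EuclideanSpace.proj j : E d →L[ℝ] ℝ).lipschitz.comp_lipschitzOnWith hB⟩

theorem ConvexPolytope.integrableOn_fderiv (K : ConvexPolytope d) {F : E d → ℝ}
    (hF : ∃ C, LipschitzOnWith C F K.carrier) (v : E d) :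
    IntegrableOn (fun x => fderiv ℝ F x v) K.carrier := by
  obtain ⟨C, hF⟩ := hF
  refine Measure.integrableOn_of_bounded (M := C * ‖v‖) K.isCompact_carrier.measure_lt_top.ne
    (measurable_fderiv_apply_const ℝ F v).aestronglyMeasurable ?_
  filter_upwards [K.ae_mem_interior] with x hx
  refine (ContinuousLinearMap.le_opNorm _ _).trans ?_
  gcongr
  exact norm_fderiv_le_of_lipschitzOn ℝ (mem_interior_iff_mem_nhds.1 hx) hF

theorem ConvexPolytope.integrableOn_facet_of_continuousOn (K : ConvexPolytope d) {s : E d × ℝ}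
    (hs : s ∈ K.halfspaces) {F : E d → ℝ} (hF : ContinuousOn F K.carrier) :
    IntegrableOn F (K.facet s) (surfaceMeasure d) := by
  have hF' := hF.mono (K.facet_subset_carrier s)
  obtain ⟨C, hC⟩ := (K.isCompact_facet s).exists_bound_of_continuousOn hF'
  refine IntegrableOn.of_bound (C := C) (K.surfaceMeasure_facet_lt_top hs) ?_ ?_
  · exact hF'.aestronglyMeasurable (K.measurableSet_facet s)
  · exact (ae_restrict_iff' (K.measurableSet_facet s)).2 (Filter.Eventually.of_forall hC)

theorem ConvexPolytope.ae_differentiableAt_field (K : ConvexPolytope d) {B : E d → E d}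
    (hB : ∃ C, LipschitzOnWith C B K.carrier) :
    ∀ᵐ x ∂(volume.restrict K.carrier), DifferentiableAt ℝ B x := by
  have h := ae_all_iff.2 fun j => K.ae_differentiableAt (lipschitzOnWith_apply hB j).choose_spec
  filter_upwards [h] with x hx
  exact differentiableAt_euclidean.2 hx

/-- Integration by parts of a Lipschitz vector field against a polynomial. -/
theorem ConvexPolytope.integration_by_parts (K : ConvexPolytope d) {B : E d → E d}
    (hB : ∃ C, LipschitzOnWith C B K.carrier) (p : MvPolynomial (Fin d) ℝ) :
    ∫ x in K.carrier, (inner ℝ (B x) (WithLp.toLp 2 fun j => polyEval (MvPolynomial.pderiv j p) x)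
        + polyEval p x * fieldDiv B x)
      = ∑ s ∈ K.halfspaces,
          ∫ x in K.facet s, inner ℝ (B x) s.1 * polyEval p x ∂(surfaceMeasure d) := by
  have hL : ∀ j, ∃ C, LipschitzOnWith C (fun x => B x j * polyEval p x) K.carrier := fun j =>
    lipschitzOnWith_mul K.isCompact_carrier (lipschitzOnWith_apply hB j)
      (K.lipschitzOnWith_polyEval p)
  -- The integrand is the sum over `j` of the `j`-th partial derivative of `B_j p`. The product rule
  -- holds almost everywhere, since a Lipschitz `B` is differentiable almost everywhere.
  have h1 : ∫ x in K.carrier,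
        (inner ℝ (B x) (WithLp.toLp 2 fun j => polyEval (MvPolynomial.pderiv j p) x)
          + polyEval p x * fieldDiv B x)
      = ∫ x in K.carrier, ∑ j, fderiv ℝ (fun x => B x j * polyEval p x) x
          (EuclideanSpace.single j 1) := by
    refine integral_congr_ae ?_
    filter_upwards [K.ae_differentiableAt_field hB] with x hx
    simp only [PiLp.inner_apply, fieldDiv, Finset.mul_sum, ← Finset.sum_add_distrib]
    refine Finset.sum_congr rfl fun j _ => ?_
    have hj : HasFDerivAt (fun x => B x j) ((EuclideanSpace.proj j : E d →L[ℝ] ℝ) ∘L fderiv ℝ B x)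
        x := (EuclideanSpace.proj j : E d →L[ℝ] ℝ).hasFDerivAt.comp x hx.hasFDerivAt
    have hp := hasFDerivAt_polyEval p x
    rw [(hj.fun_mul hp).fderiv, ← hp.fderiv]
    simp [fderiv_polyEval, mul_comm]
  rw [h1, integral_finsetSum]
  · have h2 : ∀ s ∈ K.halfspaces,
        ∫ x in K.facet s, inner ℝ (B x) s.1 * polyEval p x ∂(surfaceMeasure d)
        = ∑ j, s.1 j * ∫ x in K.facet s, B x j * polyEval p x ∂(surfaceMeasure d) := by
      intro s hs
      simp_rw [← integral_const_mul]
      rw [← integral_finsetSum]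
      · refine integral_congr_ae (Filter.Eventually.of_forall fun x => ?_)
        simp only [PiLp.inner_apply, Finset.sum_mul]
        refine Finset.sum_congr rfl fun j _ => ?_
        simp
        ring
      · intro j _
        exact (K.integrableOn_facet_of_continuousOn hs
          (hL j).choose_spec.continuousOn).const_mul _
    rw [Finset.sum_congr rfl h2, Finset.sum_comm]
    refine Finset.sum_congr rfl fun j _ => ?_
    rw [K.setIntegral_fderiv (hL j).choose_spec]
    refine Finset.sum_congr rfl fun s _ => ?_
    simp [EuclideanSpace.inner_single_right]
  · intro j _
    exact K.integrableOn_fderiv (hL j) _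

end IntegrationByParts

/-! ### Function spaces on the mesh and their pairings -/

section Spaces

variable {d : ℕ} {Ω : Set (E d)} {ι : Type*} (T : Mesh Ω ι)

/-- Square integrable functions on the elements. -/
def Mesh.L2 : Submodule ℝ (CellFun d ι) where
  carrier := {φ | ∀ i, MemLp (φ i) 2 (volume.restrict (T.cell i).carrier)}
  add_mem' ha hb i := (ha i).add (hb i)
  zero_mem' _ := MemLp.zero
  smul_mem' c _ ha i := (ha i).const_smul c

/-- Square integrable vector fields on the elements. -/
def Mesh.VL2 : Submodule ℝ (CellField d ι) where
  carrier := {φ | ∀ i, MemLp (φ i) 2 (volume.restrict (T.cell i).carrier)}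
  add_mem' ha hb i := (ha i).add (hb i)
  zero_mem' _ := MemLp.zero
  smul_mem' c _ ha i := (ha i).const_smul c

/-- Integrable functions on the element boundaries. -/
def Mesh.bdryInt : Submodule ℝ (BdryFun d ι) where
  carrier := {φ | ∀ i, ∀ s ∈ (T.cell i).halfspaces,
    IntegrableOn (φ i s.1) ((T.cell i).facet s) (surfaceMeasure d)}
  add_mem' ha hb i s hs := (ha i s hs).add (hb i s hs)
  zero_mem' _ _ _ := integrableOn_zero
  smul_mem' c _ ha i s hs := (ha i s hs).smul c

/-- Bounded measurable functions on the element boundaries. -/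
def Mesh.bdryBdd : Submodule ℝ (BdryFun d ι) where
  carrier := {ψ | ∀ i, ∀ s ∈ (T.cell i).halfspaces,
    AEStronglyMeasurable (ψ i s.1) ((surfaceMeasure d).restrict ((T.cell i).facet s)) ∧
      ∃ C, ∀ x ∈ (T.cell i).facet s, ‖ψ i s.1 x‖ ≤ C}
  add_mem' {a b} ha hb i s hs := by
    obtain ⟨h1, C, hC⟩ := ha i s hs
    obtain ⟨h1', C', hC'⟩ := hb i s hs
    exact ⟨h1.add h1', C + C', fun x hx => norm_add_le_of_le (hC x hx) (hC' x hx)⟩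
  zero_mem' _ _ _ := ⟨aestronglyMeasurable_const, 0, fun x _ => by simp⟩
  smul_mem' c a ha i s hs := by
    obtain ⟨h1, C, hC⟩ := ha i s hs
    refine ⟨h1.const_smul c, ‖c‖ * C, fun x hx => ?_⟩
    simp only [Pi.smul_apply, norm_smul]
    gcongr
    exact hC x hx

variable {T}

/-- The stabilization functions are merely integrable while all traces are bounded. This asymmetry
is why the boundary pairings are made bilinear on `bdryInt` times `bdryBdd`. -/
theorem Mesh.mul_mem_bdryInt {φ ψ : BdryFun d ι} (hφ : φ ∈ T.bdryInt) (hψ : ψ ∈ T.bdryBdd) :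
    φ * ψ ∈ T.bdryInt := by
  intro i s hs
  obtain ⟨h1, C, hC⟩ := hψ i s hs
  refine Integrable.mul_bdd (c := C) (hφ i s hs) h1 ?_
  exact (ae_restrict_iff' ((T.cell i).measurableSet_facet s)).2 (Filter.Eventually.of_forall hC)

theorem Mesh.mul_mem_bdryBdd {φ ψ : BdryFun d ι} (hφ : φ ∈ T.bdryBdd) (hψ : ψ ∈ T.bdryBdd) :
    φ * ψ ∈ T.bdryBdd := by
  intro i s hs
  obtain ⟨h1, C, hC⟩ := hφ i s hs
  obtain ⟨h1', C', hC'⟩ := hψ i s hs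
  refine ⟨h1.mul h1', C * C', fun x hx => ?_⟩
  simp only [Pi.mul_apply, norm_mul]
  exact mul_le_mul (hC x hx) (hC' x hx) (norm_nonneg _) ((norm_nonneg _).trans (hC x hx))

theorem Mesh.bdryBdd_le_bdryInt : T.bdryBdd ≤ T.bdryInt := by
  intro ψ hψ i s hs
  obtain ⟨h1, C, hC⟩ := hψ i s hs
  refine IntegrableOn.of_bound (C := C) ((T.cell i).surfaceMeasure_facet_lt_top hs) h1 ?_
  exact (ae_restrict_iff' ((T.cell i).measurableSet_facet s)).2 (Filter.Eventually.of_forall hC)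

theorem Mesh.mem_bdryBdd_of_continuousOn {ψ : BdryFun d ι}
    (h : ∀ i n, ContinuousOn (ψ i n) (T.cell i).carrier) : ψ ∈ T.bdryBdd := by
  intro i s hs
  have h' := (h i s.1).mono ((T.cell i).facet_subset_carrier s)
  exact ⟨h'.aestronglyMeasurable ((T.cell i).measurableSet_facet s),
    ((T.cell i).isCompact_facet s).exists_bound_of_continuousOn h'⟩

theorem Mesh.const_mem_bdryBdd (c : ℝ) : (fun _ _ _ => c) ∈ T.bdryBdd :=
  Mesh.mem_bdryBdd_of_continuousOn fun _ _ => continuousOn_const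

theorem Mesh.mem_L2_of_continuousOn {φ : CellFun d ι}
    (h : ∀ i, ContinuousOn (φ i) (T.cell i).carrier) : φ ∈ T.L2 := by
  intro i
  obtain ⟨C, hC⟩ := (T.cell i).isCompact_carrier.exists_bound_of_continuousOn (h i)
  have : IsFiniteMeasure (volume.restrict (T.cell i).carrier) :=
    ⟨by simpa using (T.cell i).isCompact_carrier.measure_lt_top⟩
  refine MemLp.of_bound ((h i).aestronglyMeasurable (T.cell i).measurableSet_carrier) C ?_
  exact (ae_restrict_iff' (T.cell i).measurableSet_carrier).2 (Filter.Eventually.of_forall hC)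

theorem Mesh.mem_VL2_of_continuousOn {φ : CellField d ι}
    (h : ∀ i, ContinuousOn (φ i) (T.cell i).carrier) : φ ∈ T.VL2 := by
  intro i
  obtain ⟨C, hC⟩ := (T.cell i).isCompact_carrier.exists_bound_of_continuousOn (h i)
  have : IsFiniteMeasure (volume.restrict (T.cell i).carrier) :=
    ⟨by simpa using (T.cell i).isCompact_carrier.measure_lt_top⟩
  refine MemLp.of_bound ((h i).aestronglyMeasurable (T.cell i).measurableSet_carrier) C ?_
  exact (ae_restrict_iff' (T.cell i).measurableSet_carrier).2 (Filter.Eventually.of_forall hC)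

theorem Mesh.integrableOn_mul {φ ψ : CellFun d ι} (hφ : φ ∈ T.L2) (hψ : ψ ∈ T.L2) (i : ι) :
    IntegrableOn (fun x => φ i x * ψ i x) (T.cell i).carrier :=
  (hφ i).integrable_mul (hψ i)

theorem Mesh.integrableOn_inner {φ ψ : CellField d ι} (hφ : φ ∈ T.VL2) (hψ : ψ ∈ T.VL2) (i : ι) :
    IntegrableOn (fun x => inner ℝ (φ i x) (ψ i x)) (T.cell i).carrier := by
  refine Integrable.mono' ((hφ i).norm.integrable_mul (hψ i).norm)
    ((hφ i).aestronglyMeasurable.inner (hψ i).aestronglyMeasurable)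
    (Filter.Eventually.of_forall fun x => norm_inner_le_norm _ _)

theorem Mesh.integrableOn_facet_inter {φ ψ : BdryFun d ι} (hφ : φ ∈ T.bdryInt)
    (hψ : ψ ∈ T.bdryBdd) (S : Set (E d)) (i : ι) {s : E d × ℝ} (hs : s ∈ (T.cell i).halfspaces) :
    IntegrableOn (fun x => φ i s.1 x * ψ i s.1 x) ((T.cell i).facet s ∩ S) (surfaceMeasure d) :=
  (Mesh.mul_mem_bdryInt hφ hψ i s hs).mono_set Set.inter_subset_left

variable [Fintype ι] (T)

/-- The pairing `(·,·)_{T_h}` of square integrable functions as a bilinear form. -/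
def Mesh.ipForm : T.L2 →ₗ[ℝ] T.L2 →ₗ[ℝ] ℝ :=
  LinearMap.mk₂ ℝ (fun φ ψ => T.ip φ ψ)
    (fun a b c => by
      simp only [Mesh.ip, ← Finset.sum_add_distrib]
      refine Finset.sum_congr rfl fun i _ => ?_
      rw [← integral_add (Mesh.integrableOn_mul a.2 c.2 i) (Mesh.integrableOn_mul b.2 c.2 i)]
      simp [add_mul])
    (fun r a c => by
      simp only [Mesh.ip, smul_eq_mul, Finset.mul_sum, ← integral_const_mul]
      simp [mul_assoc])
    (fun a b c => by
      simp only [Mesh.ip, ← Finset.sum_add_distrib]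
      refine Finset.sum_congr rfl fun i _ => ?_
      rw [← integral_add (Mesh.integrableOn_mul a.2 b.2 i) (Mesh.integrableOn_mul a.2 c.2 i)]
      simp [mul_add])
    (fun r a c => by
      simp only [Mesh.ip, smul_eq_mul, Finset.mul_sum, ← integral_const_mul]
      simp [mul_left_comm])

/-- The pairing `(·,·)_{T_h}` of square integrable vector fields as a bilinear form. -/
def Mesh.vipForm : T.VL2 →ₗ[ℝ] T.VL2 →ₗ[ℝ] ℝ :=
  LinearMap.mk₂ ℝ (fun φ ψ => T.vip φ ψ)
    (fun a b c => by
      simp only [Mesh.vip, ← Finset.sum_add_distrib]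
      refine Finset.sum_congr rfl fun i _ => ?_
      rw [← integral_add (Mesh.integrableOn_inner a.2 c.2 i) (Mesh.integrableOn_inner b.2 c.2 i)]
      simp [inner_add_left])
    (fun r a c => by
      simp only [Mesh.vip, smul_eq_mul, Finset.mul_sum, ← integral_const_mul]
      simp [real_inner_smul_left])
    (fun a b c => by
      simp only [Mesh.vip, ← Finset.sum_add_distrib]
      refine Finset.sum_congr rfl fun i _ => ?_
      rw [← integral_add (Mesh.integrableOn_inner a.2 b.2 i) (Mesh.integrableOn_inner a.2 c.2 i)]
      simp [inner_add_right])
    (fun r a c => by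
      simp only [Mesh.vip, smul_eq_mul, Finset.mul_sum, ← integral_const_mul]
      simp [real_inner_smul_right])

/-- The pairing on `∂T_h ∩ S` as a bilinear form. -/
def Mesh.bipForm (S : Set (E d)) : T.bdryInt →ₗ[ℝ] T.bdryBdd →ₗ[ℝ] ℝ :=
  LinearMap.mk₂ ℝ (fun φ ψ => T.bipOn S φ ψ)
    (fun a b c => by
      simp only [Mesh.bipOn, ← Finset.sum_add_distrib]
      refine Finset.sum_congr rfl fun i _ => Finset.sum_congr rfl fun s hs => ?_
      rw [← integral_add (Mesh.integrableOn_facet_inter a.2 c.2 S i hs)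
        (Mesh.integrableOn_facet_inter b.2 c.2 S i hs)]
      simp [add_mul])
    (fun r a c => by
      simp only [Mesh.bipOn, smul_eq_mul, Finset.mul_sum, ← integral_const_mul]
      simp [mul_assoc])
    (fun a b c => by
      simp only [Mesh.bipOn, ← Finset.sum_add_distrib]
      refine Finset.sum_congr rfl fun i _ => Finset.sum_congr rfl fun s hs => ?_
      rw [← integral_add (Mesh.integrableOn_facet_inter a.2 b.2 S i hs)
        (Mesh.integrableOn_facet_inter a.2 c.2 S i hs)]
      simp [mul_add])
    (fun r a c => by
      simp only [Mesh.bipOn, smul_eq_mul, Finset.mul_sum, ← integral_const_mul]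
      simp [mul_left_comm])

/-- Multiplication of integrable with bounded functions on the element boundaries. -/
def Mesh.bdryMul : T.bdryInt →ₗ[ℝ] T.bdryBdd →ₗ[ℝ] T.bdryInt :=
  LinearMap.mk₂ ℝ (fun φ ψ => ⟨φ * ψ, Mesh.mul_mem_bdryInt φ.2 ψ.2⟩)
    (fun _ _ _ => Subtype.ext (add_mul _ _ _))
    (fun _ _ _ => Subtype.ext (smul_mul_assoc _ _ _))
    (fun _ _ _ => Subtype.ext (mul_add _ _ _))
    (fun _ _ _ => Subtype.ext (mul_smul_comm _ _ _))

/-- Bounded functions on the element boundaries are integrable. -/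
def Mesh.bdryIncl : T.bdryBdd →ₗ[ℝ] T.bdryInt := Submodule.inclusion Mesh.bdryBdd_le_bdryInt

theorem Mesh.bip_eq_bipInt_add_bipBd {φ ψ : BdryFun d ι} (hφ : φ ∈ T.bdryInt)
    (hψ : ψ ∈ T.bdryBdd) : T.bip φ ψ = T.bipInt φ ψ + T.bipBd φ ψ := by
  simp only [Mesh.bip, Mesh.bipInt, Mesh.bipBd, Mesh.bipOn, ← Finset.sum_add_distrib]
  refine Finset.sum_congr rfl fun i _ => Finset.sum_congr rfl fun s hs => ?_
  have h := Mesh.mul_mem_bdryInt hφ hψ i s hs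
  rw [Set.inter_univ, add_comm, ← Set.sdiff_eq]
  exact (integral_inter_add_sdiff isClosed_frontier.measurableSet h).symm

theorem Mesh.bipOn_congr {S : Set (E d)} (hS : MeasurableSet S) {φ φ' ψ : BdryFun d ι}
    (h : ∀ i, ∀ s ∈ (T.cell i).halfspaces,
      ∀ᵐ x ∂((surfaceMeasure d).restrict ((T.cell i).facet s)),
        x ∈ S → φ i s.1 x = φ' i s.1 x) :
    T.bipOn S φ ψ = T.bipOn S φ' ψ := by
  refine Finset.sum_congr rfl fun i _ => Finset.sum_congr rfl fun s hs => ?_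
  refine setIntegral_congr_ae (((T.cell i).measurableSet_facet s).inter hS) ?_
  filter_upwards [(ae_restrict_iff' ((T.cell i).measurableSet_facet s)).1 (h i s hs)] with x hx hxS
  rw [hx hxS.1 hxS.2]

theorem Mesh.bipOn_comm (S : Set (E d)) (φ ψ : BdryFun d ι) :
    T.bipOn S φ ψ = T.bipOn S ψ φ := by
  simp only [Mesh.bipOn, mul_comm]

end Spaces

/-! ### The discrete functions as elements of the function spaces -/

section Membership

variable {d : ℕ} {Ω : Set (E d)} {ι : Type*} (T : Mesh Ω ι) {k : ℕ}

theorem continuous_val (w : Wh d ι k) (i : ι) : Continuous (val w i) := continuous_polyEval _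

theorem continuous_vval (r : Vh d ι k) (i : ι) : Continuous (vval r i) :=
  (PiLp.continuous_toLp 2 _).comp (continuous_pi fun _ => continuous_polyEval _)

theorem continuous_grad (w : Wh d ι k) (i : ι) : Continuous (grad w i) :=
  (PiLp.continuous_toLp 2 _).comp (continuous_pi fun _ => continuous_polyEval _)

theorem continuous_div (r : Vh d ι k) (i : ι) : Continuous (div r i) :=
  continuous_finsetSum _ fun _ _ => continuous_polyEval _

theorem Mesh.val_mem (w : Wh d ι k) : val w ∈ T.L2 :=
  Mesh.mem_L2_of_continuousOn fun i => (continuous_val w i).continuousOn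

theorem Mesh.div_mem (r : Vh d ι k) : div r ∈ T.L2 :=
  Mesh.mem_L2_of_continuousOn fun i => (continuous_div r i).continuousOn

theorem Mesh.vval_mem (r : Vh d ι k) : vval r ∈ T.VL2 :=
  Mesh.mem_VL2_of_continuousOn fun i => (continuous_vval r i).continuousOn

theorem Mesh.grad_mem (w : Wh d ι k) : grad w ∈ T.VL2 :=
  Mesh.mem_VL2_of_continuousOn fun i => (continuous_grad w i).continuousOn

theorem Mesh.tr_mem (w : Wh d ι k) : tr w ∈ T.bdryBdd :=
  Mesh.mem_bdryBdd_of_continuousOn fun i _ => (continuous_val w i).continuousOn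

theorem Mesh.ntr_mem (r : Vh d ι k) : ntr r ∈ T.bdryBdd :=
  Mesh.mem_bdryBdd_of_continuousOn fun i _ =>
    ((continuous_vval r i).inner continuous_const).continuousOn

theorem measurable_single {S : Set (E d)} (hS : IsCompact S) (μ : C(S, ℝ)) (i : ι) (n : E d) :
    Measurable (single μ i n : E d → ℝ) := by
  classical
  exact Measurable.dite μ.continuous.measurable measurable_const hS.isClosed.measurableSet

theorem exists_bound_single {S : Set (E d)} (hS : IsCompact S) (μ : C(S, ℝ)) :
    ∃ C, ∀ (i : ι) (n : E d) (x : E d), ‖single μ i n x‖ ≤ C := by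
  have : CompactSpace S := isCompact_iff_compactSpace.1 hS
  refine ⟨‖μ‖, fun i n x => ?_⟩
  unfold single
  split_ifs with hx
  · exact μ.norm_coe_le_norm _
  · simp

theorem Mesh.single_mem {S : Set (E d)} (hS : IsCompact S) (μ : C(S, ℝ)) :
    single μ ∈ T.bdryBdd := by
  obtain ⟨C, hC⟩ := exists_bound_single (ι := ι) hS μ
  intro i s _
  exact ⟨(measurable_single hS μ i s.1).aestronglyMeasurable, C, fun x _ => hC i s.1 x⟩

theorem Mesh.carrier_subset_closure (i : ι) : (T.cell i).carrier ⊆ closure Ω := by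
  rw [← T.iUnion_carrier]
  exact Set.subset_iUnion (fun i => (T.cell i).carrier) i

theorem Mesh.isCompact_closure [Fintype ι] (T : Mesh Ω ι) : IsCompact (closure Ω) := by
  rw [← T.iUnion_carrier]
  exact isCompact_iUnion fun i => (T.cell i).isCompact_carrier

theorem Mesh.isCompact_frontier [Fintype ι] (T : Mesh Ω ι) : IsCompact (frontier Ω) :=
  T.isCompact_closure.of_isClosed_subset isClosed_frontier frontier_subset_closure

/-- Only the interior of an element is known to lie in `Ω`; its frontier is null by convexity. -/
theorem Mesh.memLp_carrier {f : E d → ℝ} (hf : MemLp f 2 (volume.restrict Ω)) (i : ι) :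
    MemLp f 2 (volume.restrict (T.cell i).carrier) := by
  have h := hf.mono_measure (Measure.restrict_mono (T.interior_subset i) le_rfl)
  rwa [Measure.restrict_congr_set (s := interior (T.cell i).carrier) (t := (T.cell i).carrier)] at h
  have := (T.cell i).ae_mem_interior
  rw [ae_restrict_iff' (T.cell i).measurableSet_carrier] at this
  filter_upwards [this] with x hx
  exact propext ⟨fun h => _root_.interior_subset h, fun h => hx h⟩

variable {T} (D : Data T)

theorem Data.lipschitzOnWith_cell (i : ι) : ∃ C, LipschitzOnWith C D.β (T.cell i).carrier := by
  obtain ⟨C, hC⟩ := D.lipschitz_β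
  exact ⟨C, hC.mono (T.carrier_subset_closure i)⟩

theorem Data.continuousOn_cell (i : ι) : ContinuousOn D.β (T.cell i).carrier :=
  (D.lipschitzOnWith_cell i).choose_spec.continuousOn

theorem Data.fc_mem : D.fc ∈ T.L2 := fun i => T.memLp_carrier D.memLp_f i

theorem Data.ydc_mem : D.ydc ∈ T.L2 := fun i => T.memLp_carrier D.memLp_yd i

theorem Data.βmul_mem (w : Wh d ι k) : D.βmul w ∈ T.VL2 :=
  Mesh.mem_VL2_of_continuousOn fun i =>
    (continuous_val w i).continuousOn.smul (D.continuousOn_cell i)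

theorem Data.βn_mem : D.βn ∈ T.bdryBdd :=
  Mesh.mem_bdryBdd_of_continuousOn fun i _ => (D.continuousOn_cell i).inner continuousOn_const

/-- At interior points the derivative of `β` is bounded by its Lipschitz constant, hence `∇·β` is
essentially bounded on each element. -/
theorem Data.divβ_mem (w : Wh d ι k) : D.divβ w ∈ T.L2 := by
  intro i
  obtain ⟨C, hC⟩ := D.lipschitzOnWith_cell i
  obtain ⟨M, hM⟩ := (T.cell i).isCompact_carrier.exists_bound_of_continuousOn
    (continuous_val w i).continuousOn
  have : IsFiniteMeasure (volume.restrict (T.cell i).carrier) :=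
    ⟨by simpa using (T.cell i).isCompact_carrier.measure_lt_top⟩
  have hmeas : Measurable (fieldDiv D.β) := by
    unfold fieldDiv
    refine Finset.measurable_sum _ fun j _ => ?_
    exact (EuclideanSpace.proj j : E d →L[ℝ] ℝ).continuous.measurable.comp
      (measurable_fderiv_apply_const ℝ D.β _)
  refine MemLp.of_bound ((continuous_val w i).measurable.mul hmeas).aestronglyMeasurable
    (M * ∑ _j : Fin d, (C : ℝ)) ?_
  rw [ae_restrict_iff' (T.cell i).measurableSet_carrier]
  filter_upwards [(ae_restrict_iff' (T.cell i).measurableSet_carrier).1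
    (T.cell i).ae_mem_interior] with x hx hxK
  have h1 := norm_fderiv_le_of_lipschitzOn ℝ (mem_interior_iff_mem_nhds.1 (hx hxK)) hC
  have h2 : ‖fieldDiv D.β x‖ ≤ ∑ _j : Fin d, (C : ℝ) := by
    refine norm_sum_le_of_le _ fun j _ => ?_
    refine (PiLp.norm_apply_le _ j).trans ((ContinuousLinearMap.le_opNorm _ _).trans ?_)
    simpa using h1
  rw [Data.divβ, norm_mul]
  exact mul_le_mul (hM x hxK) h2 (norm_nonneg _) ((norm_nonneg _).trans (hM x hxK))

theorem Data.Ig_mem [Fintype ι] : D.Ig ∈ T.bdryBdd := T.single_mem T.isCompact_frontier _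

theorem Data.stab_mem : D.hinv + D.τ₁ ∈ T.bdryInt :=
  add_mem (Mesh.bdryBdd_le_bdryInt (Mesh.const_mem_bdryBdd _)) D.integrable_τ₁

theorem Data.stab₂_mem : D.hinv + D.τ₂ ∈ T.bdryInt :=
  add_mem (Mesh.bdryBdd_le_bdryInt (Mesh.const_mem_bdryBdd _)) D.integrable_τ₂

theorem Mesh.single_trace_mem [Fintype ι] (T : Mesh Ω ι) (μ : Mo T k) :
    single μ.toFun ∈ T.bdryBdd :=
  T.single_mem T.isCompact_interiorSkeleton _

end Membership

/-! ### Integration by parts on the mesh -/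

section MeshIntegrationByParts

variable {d : ℕ} {Ω : Set (E d)} {ι : Type*} {T : Mesh Ω ι} {k : ℕ}

theorem fieldDiv_vval (r : Vh d ι k) (i : ι) (x : E d) : fieldDiv (vval r i) x = div r i x := by
  unfold fieldDiv div
  refine Finset.sum_congr rfl fun j _ => ?_
  have hd : DifferentiableAt ℝ (vval r i) x :=
    differentiableAt_euclidean.2 fun j => (hasFDerivAt_polyEval _ x).differentiableAt
  have h := (EuclideanSpace.proj j : E d →L[ℝ] ℝ).hasFDerivAt.comp x hd.hasFDerivAt
  have h' : (EuclideanSpace.proj j : E d →L[ℝ] ℝ) ∘ vval r i = polyEval (r i j).toMv := rfl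
  rw [← fderiv_polyEval, ← h', h.fderiv]
  rfl

theorem lipschitzOnWith_vval (r : Vh d ι k) (i : ι) (K : ConvexPolytope d) :
    ∃ C, LipschitzOnWith C (vval r i) K.carrier := by
  refine ContDiffOn.exists_lipschitzOnWith (n := 1) ?_ one_ne_zero K.convex_carrier
    K.isCompact_carrier
  exact (contDiff_euclidean.2 fun j => contDiff_polyEval _).contDiffOn

variable [Fintype ι]

theorem Mesh.vip_vval_grad (T : Mesh Ω ι) (r : Vh d ι k) (w : Wh d ι k) :
    T.vip (vval r) (grad w) + T.ip (val w) (div r) = T.bip (ntr r) (tr w) := by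
  simp only [Mesh.vip, Mesh.ip, Mesh.bip, Mesh.bipOn, ← Finset.sum_add_distrib]
  refine Finset.sum_congr rfl fun i _ => ?_
  rw [← integral_add (Mesh.integrableOn_inner (T.vval_mem r) (T.grad_mem w) i)
    (Mesh.integrableOn_mul (T.val_mem w) (T.div_mem r) i)]
  have h := (T.cell i).integration_by_parts (lipschitzOnWith_vval r i (T.cell i)) (w i).toMv
  simp only [fieldDiv_vval] at h
  simp only [Set.inter_univ]
  exact h

/-- Integration by parts of `β` against the product polynomial `y z`. The boundary term is the
source of the shift by `β·n` between the two stabilizations. -/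
theorem Data.vip_βmul_grad (D : Data T) (y z : Wh d ι k) :
    T.vip (D.βmul y) (grad z) + T.vip (D.βmul z) (grad y) + T.ip (D.divβ y) (val z)
      = T.bip (D.βn * tr y) (tr z) := by
  simp only [Mesh.vip, Mesh.ip, Mesh.bip, Mesh.bipOn, ← Finset.sum_add_distrib]
  refine Finset.sum_congr rfl fun i _ => ?_
  have i1 := Mesh.integrableOn_inner (D.βmul_mem y) (T.grad_mem z) i
  have i2 := Mesh.integrableOn_inner (D.βmul_mem z) (T.grad_mem y) i
  have i3 := Mesh.integrableOn_mul (D.divβ_mem y) (T.val_mem z) i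
  rw [← integral_add i1 i2]
  refine (integral_add (i1.add i2) i3).symm.trans ?_
  have h := (T.cell i).integration_by_parts (D.lipschitzOnWith_cell i) ((y i).toMv * (z i).toMv)
  simp only [Set.inter_univ]
  convert h using 1
  · refine integral_congr_ae (Filter.Eventually.of_forall fun x => ?_)
    have h1 : (WithLp.toLp 2 fun j =>
        polyEval (MvPolynomial.pderiv j ((y i).toMv * (z i).toMv)) x : E d)
        = val y i x • grad z i x + val z i x • grad y i x := by
      ext j
      simp [val, grad, polyEval, Derivation.leibniz]
    have h2 : polyEval ((y i).toMv * (z i).toMv) x = val y i x * val z i x := by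
      simp [val, polyEval]
    simp only [Pi.add_apply, Data.βmul, Data.divβ, h1, h2, real_inner_smul_left, real_inner_smul_right,
      inner_add_right]
    ring
  · refine Finset.sum_congr rfl fun s _ => ?_
    refine integral_congr_ae (Filter.Eventually.of_forall fun x => ?_)
    simp only [Pi.mul_apply, Data.βn, tr, polyEval, map_mul]
    ring

end MeshIntegrationByParts

/-! ### Cancellation of single-valued normal fluxes across interior faces -/

section Cancellation

variable {d : ℕ} {Ω : Set (E d)} {ι : Type*} (T : Mesh Ω ι)

theorem integral_fderiv_eq_zero {φ : E d → ℝ} (hφ : ContDiff ℝ 1 φ) (hc : HasCompactSupport φ)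
    (v : E d) : ∫ x, fderiv ℝ φ x v = 0 := by
  have h := integral_mul_fderiv_eq_neg_fderiv_mul_of_integrable (μ := volume) (f := fun _ => (1 : ℝ))
    (g := φ) (v := v) (by simp) ?_ (by simpa using hφ.continuous.integrable_of_hasCompactSupport hc)
    (fun x _ => differentiableAt_const _) (fun x _ => hφ.differentiable one_ne_zero x)
  · simpa using h
  · simp only [one_mul]
    refine Continuous.integrable_of_hasCompactSupport ?_ ((hc.fderiv (𝕜 := ℝ)).comp_left
      (g := fun L : E d →L[ℝ] ℝ => L v) rfl)
    exact (hφ.continuous_fderiv one_ne_zero).clm_apply continuous_const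

theorem Mesh.aedisjoint_carrier :
    Pairwise (Function.onFun (AEDisjoint volume) fun i => (T.cell i).carrier) := by
  intro i j hij
  have hi := (T.cell i).convex_carrier.addHaar_frontier volume
  have hj := (T.cell j).convex_carrier.addHaar_frontier volume
  refine measure_mono_null ?_ (measure_union_null hi hj)
  rintro x ⟨hxi, hxj⟩
  by_contra hx
  have hxi' : x ∈ interior (T.cell i).carrier := by
    by_contra h
    exact hx (Or.inl ⟨subset_closure hxi, h⟩)
  have hxj' : x ∈ interior (T.cell j).carrier := by
    by_contra h
    exact hx (Or.inr ⟨subset_closure hxj, h⟩)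
  exact Set.disjoint_left.1 (T.disjoint_interior i j hij) hxi' hxj'

/-- The union of all facets. -/
def Mesh.facets : Set (E d) := ⋃ i, ⋃ s ∈ (T.cell i).halfspaces, (T.cell i).facet s

theorem Mesh.facet_subset_facets (i : ι) {s : E d × ℝ} (hs : s ∈ (T.cell i).halfspaces) :
    (T.cell i).facet s ⊆ T.facets := fun _ hx =>
  Set.mem_iUnion.2 ⟨i, Set.mem_iUnion₂.2 ⟨s, hs, hx⟩⟩

theorem Mesh.facet_inter_compl_frontier (hΩ : IsOpen Ω) (i : ι) (s : E d × ℝ) :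
    (T.cell i).facet s ∩ (frontier Ω)ᶜ = (T.cell i).facet s ∩ Ω := by
  ext x
  refine and_congr_right fun hx => ?_
  have h := T.carrier_subset_closure i hx.1
  rw [hΩ.frontier_eq]
  simp [h]

variable [Fintype ι]

/-- Weak form of the cancellation of normals: the facet terms add up to the integral of a derivative
of a compactly supported function over the whole space. No matching of facets is required. -/
theorem Mesh.sum_facet_integral_eq_zero {φ : E d → ℝ} (hφ : ContDiff ℝ 1 φ)
    (hc : HasCompactSupport φ) (hsub : tsupport φ ⊆ Ω) (v : E d) :
    ∑ i, ∑ s ∈ (T.cell i).halfspaces,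
      inner ℝ s.1 v * ∫ x in (T.cell i).facet s, φ x ∂(surfaceMeasure d) = 0 := by
  have hL : ∀ i, ∃ C, LipschitzOnWith C φ (T.cell i).carrier := fun i =>
    hφ.contDiffOn.exists_lipschitzOnWith one_ne_zero (T.cell i).convex_carrier
      (T.cell i).isCompact_carrier
  have hint : Integrable (fun x => fderiv ℝ φ x v) := by
    refine Continuous.integrable_of_hasCompactSupport ?_ ((hc.fderiv (𝕜 := ℝ)).comp_left
      (g := fun L : E d →L[ℝ] ℝ => L v) rfl)
    exact (hφ.continuous_fderiv one_ne_zero).clm_apply continuous_const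
  calc _ = ∑ i, ∫ x in (T.cell i).carrier, fderiv ℝ φ x v :=
        Finset.sum_congr rfl fun i _ => ((T.cell i).setIntegral_fderiv (hL i).choose_spec v).symm
    _ = ∫ x in ⋃ i, (T.cell i).carrier, fderiv ℝ φ x v := by
        rw [integral_iUnion_ae (fun i => (T.cell i).measurableSet_carrier.nullMeasurableSet)
          T.aedisjoint_carrier hint.integrableOn, tsum_fintype]
    _ = ∫ x, fderiv ℝ φ x v := by
        rw [T.iUnion_carrier]
        refine setIntegral_eq_integral_of_forall_compl_eq_zero fun x hx => ?_
        have hx' : x ∉ tsupport φ := fun h => hx (subset_closure (hsub h))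
        have hx'' := fun h => hx' (tsupport_fderiv_subset ℝ h)
        rw [image_eq_zero_of_notMem_tsupport hx'']
        rfl
    _ = 0 := integral_fderiv_eq_zero hφ hc v

theorem Mesh.surfaceMeasure_facets_lt_top : surfaceMeasure d T.facets < ⊤ := by
  refine (measure_iUnion_fintype_le _ _).trans_lt (ENNReal.sum_lt_top.2 fun i _ => ?_)
  refine (measure_biUnion_finset_le _ _).trans_lt (ENNReal.sum_lt_top.2 fun s hs => ?_)
  exact (T.cell i).surfaceMeasure_facet_lt_top hs

/-- The sum of the outward unit normals of all elements at a point. -/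
def Mesh.normalSum (x : E d) : E d :=
  ∑ i, ∑ s ∈ (T.cell i).halfspaces, ((T.cell i).facet s).indicator (fun _ => s.1) x

theorem Mesh.integrableOn_normalSum :
    IntegrableOn T.normalSum T.facets (surfaceMeasure d) := by
  have : IsFiniteMeasure ((surfaceMeasure d).restrict T.facets) :=
    ⟨by simpa using T.surfaceMeasure_facets_lt_top⟩
  refine integrable_finsetSum _ fun i _ => integrable_finsetSum _ fun s _ => ?_
  exact (integrable_const _).indicator ((T.cell i).measurableSet_facet s)

/-- The outward unit normals cancel almost everywhere on the facets inside the domain. -/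
theorem Mesh.ae_normalSum_eq_zero (hΩ : IsOpen Ω) :
    ∀ᵐ x ∂((surfaceMeasure d).restrict T.facets), x ∈ Ω → T.normalSum x = 0 := by
  have : IsFiniteMeasure ((surfaceMeasure d).restrict T.facets) :=
    ⟨by simpa using T.surfaceMeasure_facets_lt_top⟩
  -- The fundamental lemma of the calculus of variations, for surface measure on the facets.
  refine hΩ.ae_eq_zero_of_integral_contDiff_smul_eq_zero
    ((Integrable.locallyIntegrable T.integrableOn_normalSum).locallyIntegrableOn _) ?_
  intro φ hφ hc hsub
  obtain ⟨C, hC⟩ := hφ.continuous.bounded_above_of_compact_support hc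
  have hφi : Integrable φ ((surfaceMeasure d).restrict T.facets) :=
    Integrable.of_bound hφ.continuous.aestronglyMeasurable C (Filter.Eventually.of_forall hC)
  have hterm : ∀ i, ∀ s : E d × ℝ,
      Integrable (fun x => φ x • ((T.cell i).facet s).indicator (fun _ => s.1) x)
        ((surfaceMeasure d).restrict T.facets) := by
    intro i s
    have h := (hφi.smul_const s.1).indicator ((T.cell i).measurableSet_facet s)
    refine h.congr (Filter.Eventually.of_forall fun x => ?_)
    by_cases hx : x ∈ (T.cell i).facet s <;> simp [hx]
  have hval : ∀ i, ∀ s ∈ (T.cell i).halfspaces,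
      ∫ x in T.facets, φ x • ((T.cell i).facet s).indicator (fun _ => s.1) x ∂(surfaceMeasure d)
        = (∫ x in (T.cell i).facet s, φ x ∂(surfaceMeasure d)) • s.1 := by
    intro i s hs
    rw [← integral_smul_const, ← Set.inter_eq_right.2 (T.facet_subset_facets i hs),
      ← setIntegral_indicator ((T.cell i).measurableSet_facet s),
      Set.inter_eq_right.2 (T.facet_subset_facets i hs)]
    refine integral_congr_ae (Filter.Eventually.of_forall fun x => ?_)
    by_cases hx : x ∈ (T.cell i).facet s <;> simp [hx]
  simp only [Mesh.normalSum, Finset.smul_sum]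
  rw [integral_finsetSum _ fun i _ => integrable_finsetSum _ fun s _ => hterm i s]
  simp_rw [integral_finsetSum _ fun s _ => hterm _ s]
  rw [Finset.sum_congr rfl fun i _ => Finset.sum_congr rfl fun s hs => hval i s hs]
  -- The vector-valued integral vanishes because its component along every `v` does.
  refine ext_inner_right ℝ fun v => ?_
  rw [inner_zero_left, ← T.sum_facet_integral_eq_zero (hφ.of_le (by simp)) hc hsub v]
  simp only [sum_inner, real_inner_smul_left, mul_comm]

/-- The normal fluxes of a single-valued field cancel on the interior faces. -/
theorem Mesh.sum_facet_inter_inner_eq_zero (hΩ : IsOpen Ω) {B : E d → E d}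
    (hB : ∀ i, ∀ s ∈ (T.cell i).halfspaces,
      IntegrableOn (fun x => inner ℝ (B x) s.1) ((T.cell i).facet s) (surfaceMeasure d)) :
    ∑ i, ∑ s ∈ (T.cell i).halfspaces,
      ∫ x in (T.cell i).facet s ∩ (frontier Ω)ᶜ, inner ℝ (B x) s.1 ∂(surfaceMeasure d) = 0 := by
  have hmeasΩ := hΩ.measurableSet
  have hint : ∀ i, ∀ s ∈ (T.cell i).halfspaces,
      Integrable (((T.cell i).facet s ∩ Ω).indicator fun x => inner ℝ (B x) s.1)
        ((surfaceMeasure d).restrict T.facets) := by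
    intro i s hs
    have hm := ((T.cell i).measurableSet_facet s).inter hmeasΩ
    exact (integrable_indicator_iff hm).2
      (((hB i s hs).mono_set Set.inter_subset_left).mono_measure Measure.restrict_le_self)
  have hval : ∀ i, ∀ s ∈ (T.cell i).halfspaces,
      ∫ x in (T.cell i).facet s ∩ (frontier Ω)ᶜ, inner ℝ (B x) s.1 ∂(surfaceMeasure d)
      = ∫ x in T.facets, ((T.cell i).facet s ∩ Ω).indicator (fun x => inner ℝ (B x) s.1) x
          ∂(surfaceMeasure d) := by
    intro i s hs
    have hm := ((T.cell i).measurableSet_facet s).inter hmeasΩ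
    rw [T.facet_inter_compl_frontier hΩ, setIntegral_indicator hm, Set.inter_eq_right.2
      (Set.inter_subset_left.trans (T.facet_subset_facets i hs))]
  rw [Finset.sum_congr rfl fun i _ => Finset.sum_congr rfl fun s hs => hval i s hs]
  rw [Finset.sum_congr rfl fun i _ => (integral_finsetSum _ fun s hs => hint i s hs).symm,
    ← integral_finsetSum _ fun i _ => integrable_finsetSum _ fun s hs => hint i s hs]
  -- With all facet integrals gathered over one common set, the integrand at a point of `Ω` is the
  -- inner product of `B` with the sum of the normals.
  refine integral_eq_zero_of_ae ?_
  filter_upwards [T.ae_normalSum_eq_zero hΩ] with x hx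
  by_cases hxΩ : x ∈ Ω
  · have h : ∀ i, ∀ s : E d × ℝ,
        ((T.cell i).facet s ∩ Ω).indicator (fun x => inner ℝ (B x) s.1) x
          = inner ℝ (B x) (((T.cell i).facet s).indicator (fun _ => s.1) x) := by
      intro i s
      by_cases hxs : x ∈ (T.cell i).facet s <;> simp [hxs, hxΩ]
    simp only [h, ← inner_sum]
    change inner ℝ (B x) (T.normalSum x) = 0
    rw [hx hxΩ, inner_zero_right]
  · simp [hxΩ]

/-- This term is the sole discrepancy between the trace equations for the state in the two
approaches. -/
theorem Data.bipInt_βn_single_eq_zero {T : Mesh Ω ι} {k : ℕ} (D : Data T) (hΩ : IsOpen Ω)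
    (a b : Mo T k) : T.bipInt (D.βn * single a.toFun) (single b.toFun) = 0 := by
  have h0 := Mesh.mul_mem_bdryInt (Mesh.bdryBdd_le_bdryInt (Mesh.mul_mem_bdryBdd D.βn_mem
    (T.single_trace_mem a))) (T.single_trace_mem b)
  -- `single` ignores the element and the normal, so dummy values `()` and `0` serve.
  let c : E d → ℝ := fun x =>
    (single a.toFun : BdryFun d Unit) () 0 x * (single b.toFun : BdryFun d Unit) () 0 x
  have heq : ∀ (i : ι) (n x : E d),
      (D.βn * single a.toFun * single b.toFun : BdryFun d ι) i n x = inner ℝ (c x • D.β x) n := by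
    intro i n x
    rw [real_inner_smul_left]
    simp only [Pi.mul_apply, Data.βn, single, c]
    ring
  have h := T.sum_facet_inter_inner_eq_zero hΩ (B := fun x => c x • D.β x) fun i s hs => by
    refine (h0 i s hs).congr (Filter.Eventually.of_forall fun x => heq i s.1 x)
  rw [← h, Mesh.bipInt, Mesh.bipOn]
  refine Finset.sum_congr rfl fun i _ => Finset.sum_congr rfl fun s _ => ?_
  exact integral_congr_ae (Filter.Eventually.of_forall fun x => heq i s.1 x)

end Cancellation

/-! ### The trace space is finite-dimensional -/

section TraceSpace

variable {d : ℕ} {Ω : Set (E d)} {ι : Type*} [Fintype ι]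

/-- A trace function is determined by its restrictions to the finitely many interior faces, and
these come from polynomials of bounded degree. Finite dimension yields both the multipliers and the
continuity of the derivatives. -/
instance finiteDimensional_Mo (T : Mesh Ω ι) (k : ℕ) : FiniteDimensional ℝ (Mo T k) := by
  classical
  -- A polynomial representing a trace on a face is not unique, so the comparison is between values
  -- on faces, cut off by zero elsewhere.
  let A : (ι × ι → Poly d (k + 1)) →ₗ[ℝ] (ι × ι → T.interiorSkeleton → ℝ) :=
    { toFun := fun P ij x => if T.IsInteriorFace ij.1 ij.2 ∧ (x : E d) ∈ T.commonFace ij.1 ij.2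
        then polyEval (P ij).toMv x else 0
      map_add' := fun P Q => by
        ext ij x
        simp only [Pi.add_apply]
        split_ifs <;> simp [polyEval]
      map_smul' := fun c P => by
        ext ij x
        simp only [Pi.smul_apply]
        split_ifs <;> simp [polyEval] }
  let R : Mo T k →ₗ[ℝ] (ι × ι → T.interiorSkeleton → ℝ) :=
    { toFun := fun μ ij x => if T.IsInteriorFace ij.1 ij.2 ∧ (x : E d) ∈ T.commonFace ij.1 ij.2
        then μ.toFun x else 0
      map_add' := fun μ ν => by
        ext ij x
        simp only [Pi.add_apply]
        split_ifs
        · rfl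
        · simp
      map_smul' := fun c μ => by
        ext ij x
        simp only [Pi.smul_apply]
        split_ifs
        · rfl
        · simp }
  have hRA : ∀ μ, R μ ∈ LinearMap.range A := by
    intro μ
    have hμ : ∀ i j, T.IsInteriorFace i j → ∃ p : Poly d (k + 1),
        ∀ x : T.interiorSkeleton, (x : E d) ∈ T.commonFace i j → μ.toFun x = polyEval p.toMv x :=
      Subtype.property (p := (· ∈ traceSubmodule T k)) μ
    have hμ' : ∀ ij : ι × ι, ∃ p : Poly d (k + 1), T.IsInteriorFace ij.1 ij.2 →
        ∀ x : T.interiorSkeleton, (x : E d) ∈ T.commonFace ij.1 ij.2 →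
          μ.toFun x = polyEval p.toMv x := by
      intro ij
      by_cases h : T.IsInteriorFace ij.1 ij.2
      · obtain ⟨p, hp⟩ := hμ _ _ h
        exact ⟨p, fun _ => hp⟩
      · exact ⟨0, fun h' => absurd h' h⟩
    choose P hP using hμ'
    refine ⟨P, ?_⟩
    ext ij x
    change (if _ then _ else _) = (if _ then _ else _)
    split_ifs with h
    · exact (hP ij h.1 x h.2).symm
    · rfl
  have hinj : Function.Injective R := by
    intro μ ν h
    refine Subtype.ext (p := (· ∈ traceSubmodule T k)) (ContinuousMap.ext fun x => ?_)
    obtain ⟨i, hx⟩ := Set.mem_iUnion.1 x.2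
    obtain ⟨j, hx⟩ := Set.mem_iUnion.1 hx
    obtain ⟨hij, hx⟩ := Set.mem_iUnion.1 hx
    have h1 := congrFun (congrFun h (i, j)) x
    change (if _ then _ else _) = (if _ then _ else _) at h1
    rwa [if_pos ⟨hij, hx⟩, if_pos ⟨hij, hx⟩] at h1
  exact Module.Finite.of_injective (R.codRestrict (LinearMap.range A) hRA)
    fun μ ν h => hinj (congrArg Subtype.val h)

end TraceSpace

/-! ### The discrete functions as linear maps into the function spaces -/

section LinearMaps

variable {d : ℕ} {Ω : Set (E d)} {ι : Type*} (T : Mesh Ω ι) {k : ℕ}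

/-- `val` as a linear map. -/
def Mesh.valL : Wh d ι k →ₗ[ℝ] T.L2 where
  toFun w := ⟨val w, T.val_mem w⟩
  map_add' a b := by ext; simp [val, polyEval]
  map_smul' c a := by ext; simp [val, polyEval]

/-- `vval` as a linear map. -/
def Mesh.vvalL : Vh d ι k →ₗ[ℝ] T.VL2 where
  toFun r := ⟨vval r, T.vval_mem r⟩
  map_add' a b := by ext; simp [vval, polyEval]
  map_smul' c a := by ext; simp [vval, polyEval]

/-- `grad` as a linear map. -/
def Mesh.gradL : Wh d ι k →ₗ[ℝ] T.VL2 where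
  toFun w := ⟨grad w, T.grad_mem w⟩
  map_add' a b := by ext; simp [grad, polyEval]
  map_smul' c a := by ext; simp [grad, polyEval]

/-- `div` as a linear map. -/
def Mesh.divL : Vh d ι k →ₗ[ℝ] T.L2 where
  toFun r := ⟨div r, T.div_mem r⟩
  map_add' a b := by ext; simp [div, polyEval, Finset.sum_add_distrib]
  map_smul' c a := by ext; simp [div, polyEval, Finset.mul_sum]

/-- `tr` as a linear map. -/
def Mesh.trL : Wh d ι k →ₗ[ℝ] T.bdryBdd where
  toFun w := ⟨tr w, T.tr_mem w⟩
  map_add' a b := by ext; simp [tr, polyEval]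
  map_smul' c a := by ext; simp [tr, polyEval]

/-- `ntr` as a linear map. -/
def Mesh.ntrL : Vh d ι k →ₗ[ℝ] T.bdryBdd where
  toFun r := ⟨ntr r, T.ntr_mem r⟩
  map_add' a b := by
    have h : ∀ i x, vval (a + b) i x = vval a i x + vval b i x := by
      intro i x; ext; simp [vval, polyEval]
    ext
    simp [ntr, h, inner_add_left]
  map_smul' c a := by
    have h : ∀ i x, vval (c • a) i x = c • vval a i x := by
      intro i x; ext; simp [vval, polyEval]
    ext
    simp [ntr, h, real_inner_smul_left]

/-- The trace functions as a linear map into the functions on the element boundaries. -/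
def Mesh.singleL [Fintype ι] : Mo T k →ₗ[ℝ] T.bdryBdd where
  toFun μ := ⟨single μ.toFun, T.single_trace_mem μ⟩
  map_add' a b := by
    ext i n x
    change single _ i n x = single _ i n x + single _ i n x
    simp only [single]
    split_ifs
    · rfl
    · simp
  map_smul' c a := by
    ext i n x
    change single _ i n x = c * single _ i n x
    simp only [single]
    split_ifs
    · rfl
    · simp

variable {T} (D : Data T)

/-- Multiplication by `β` as a linear map. -/
def Data.βmulL : Wh d ι k →ₗ[ℝ] T.VL2 where
  toFun w := ⟨D.βmul w, D.βmul_mem w⟩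
  map_add' a b := by ext; simp [Data.βmul, val, polyEval, add_mul]
  map_smul' c a := by ext; simp [Data.βmul, val, polyEval, mul_assoc]

/-- Multiplication by `∇·β` as a linear map. -/
def Data.divβL : Wh d ι k →ₗ[ℝ] T.L2 where
  toFun w := ⟨D.divβ w, D.divβ_mem w⟩
  map_add' a b := by ext; simp [Data.divβ, val, polyEval, add_mul]
  map_smul' c a := by ext; simp [Data.divβ, val, polyEval, mul_assoc]

/-- `β · n` as a bounded function on the element boundaries. -/
def Data.βnE : T.bdryBdd := ⟨D.βn, D.βn_mem⟩

/-- The stabilization coefficient `h⁻¹ + τ₁`. -/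
def Data.stab : T.bdryInt := ⟨D.hinv + D.τ₁, D.stab_mem⟩

/-- The desired state as a square integrable function. -/
def Data.ydE : T.L2 := ⟨D.ydc, D.ydc_mem⟩

/-- The source as a square integrable function. -/
def Data.fE : T.L2 := ⟨D.fc, D.fc_mem⟩

/-- The boundary datum as a bounded function. -/
def Data.IgE [Fintype ι] : T.bdryBdd := ⟨D.Ig, D.Ig_mem⟩

end LinearMaps

/-! ### Numerical fluxes expressed through the bilinear pairings -/

section Forms

variable {d : ℕ} {Ω : Set (E d)} {ι : Type*} (T : Mesh Ω ι)

open Classical in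
theorem Mesh.piecewise_mem {a b : BdryFun d ι} (ha : a ∈ T.bdryBdd) (hb : b ∈ T.bdryBdd) :
    (fun i n x => if x ∈ frontier Ω then a i n x else b i n x) ∈ T.bdryBdd := by
  intro i s hs
  obtain ⟨h1, C, hC⟩ := ha i s hs
  obtain ⟨h2, C', hC'⟩ := hb i s hs
  refine ⟨?_, max C C', fun x hx => ?_⟩
  · exact AEStronglyMeasurable.piecewise (f := a i s.1) (g := b i s.1)
      isClosed_frontier.measurableSet h1.restrict h2.restrict
  · dsimp only
    split_ifs
    · exact (hC x hx).trans (le_max_left _ _)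
    · exact (hC' x hx).trans (le_max_right _ _)

variable [Fintype ι]

/-- The pairing on the whole element boundaries. -/
abbrev Mesh.bForm : T.bdryInt →ₗ[ℝ] T.bdryBdd →ₗ[ℝ] ℝ := T.bipForm Set.univ

/-- The pairing on the interior part of the element boundaries. -/
abbrev Mesh.bIntForm : T.bdryInt →ₗ[ℝ] T.bdryBdd →ₗ[ℝ] ℝ := T.bipForm (frontier Ω)ᶜ

/-- The pairing on the boundary faces. -/
abbrev Mesh.bBdForm : T.bdryInt →ₗ[ℝ] T.bdryBdd →ₗ[ℝ] ℝ := T.bipForm (frontier Ω)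

theorem Mesh.bForm_eq (φ : T.bdryInt) (ψ : T.bdryBdd) :
    T.bForm φ ψ = T.bIntForm φ ψ + T.bBdForm φ ψ :=
  T.bip_eq_bipInt_add_bipBd φ.2 ψ.2

variable {T} (D : Data T) {k : ℕ}

open Classical in
theorem Data.qhat_mem (q : Vh d ι k) (y : Wh d ι k) (yo : Mo T k) :
    D.qhat q y yo ∈ T.bdryInt := by
  have h : D.qhat q y yo = ntr q + (D.hinv + D.τ₁) * (tr y -
      fun i n x => if x ∈ frontier Ω then D.Ig i n x else single yo.toFun i n x) := by
    ext i n x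
    simp only [Data.qhat, Pi.add_apply, Pi.mul_apply, Pi.sub_apply, Data.hinv]
    split_ifs <;> ring
  rw [h]
  exact add_mem (Mesh.bdryBdd_le_bdryInt (T.ntr_mem q)) (Mesh.mul_mem_bdryInt D.stab_mem
    (sub_mem (T.tr_mem y) (T.piecewise_mem D.Ig_mem (T.single_trace_mem yo))))

open Classical in
theorem Data.phat_mem (p : Vh d ι k) (z : Wh d ι k) (zo : Mo T k) :
    D.phat p z zo ∈ T.bdryInt := by
  have h : D.phat p z zo = ntr p + (D.hinv + D.τ₂) * (tr z -
      fun i n x => if x ∈ frontier Ω then (0 : BdryFun d ι) i n x else single zo.toFun i n x) := by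
    ext i n x
    simp only [Data.phat, Pi.add_apply, Pi.mul_apply, Pi.sub_apply, Data.hinv, Pi.zero_apply]
    split_ifs <;> ring
  rw [h]
  exact add_mem (Mesh.bdryBdd_le_bdryInt (T.ntr_mem p)) (Mesh.mul_mem_bdryInt D.stab₂_mem
    (sub_mem (T.tr_mem z) (T.piecewise_mem (zero_mem _) (T.single_trace_mem zo))))

theorem Data.bipInt_qhat (q : Vh d ι k) (y : Wh d ι k) (yo : Mo T k) (ψ : T.bdryBdd) :
    T.bipInt (D.qhat q y yo) ψ
      = T.bIntForm (T.bdryIncl (T.ntrL q)) ψ + T.bIntForm (T.bdryMul D.stab (T.trL y)) ψ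
        - T.bIntForm (T.bdryMul D.stab (T.singleL yo)) ψ := by
  have h : T.bipInt (D.qhat q y yo) ψ
      = T.bIntForm (T.bdryIncl (T.ntrL q) + T.bdryMul D.stab (T.trL y - T.singleL yo)) ψ := by
    refine T.bipOn_congr isClosed_frontier.measurableSet.compl fun i s _ =>
      Filter.Eventually.of_forall fun x hx => ?_
    change D.qhat q y yo i s.1 x = ntr q i s.1 x + (D.h⁻¹ + D.τ₁ i s.1 x) *
      (tr y i s.1 x - single yo.toFun i s.1 x)
    rw [Data.qhat, if_neg hx]
    ring
  rw [h]
  simp only [map_add, map_sub, LinearMap.add_apply, LinearMap.sub_apply]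
  ring

theorem Data.bip_qhat (q : Vh d ι k) (y : Wh d ι k) (yo : Mo T k) (ψ : T.bdryBdd) :
    T.bip (D.qhat q y yo) ψ
      = T.bForm (T.bdryIncl (T.ntrL q)) ψ + T.bForm (T.bdryMul D.stab (T.trL y)) ψ
        - T.bIntForm (T.bdryMul D.stab (T.singleL yo)) ψ
        - T.bBdForm (T.bdryMul D.stab D.IgE) ψ := by
  have h : T.bipBd (D.qhat q y yo) ψ
      = T.bBdForm (T.bdryIncl (T.ntrL q) + T.bdryMul D.stab (T.trL y - D.IgE)) ψ := by
    refine T.bipOn_congr isClosed_frontier.measurableSet fun i s _ =>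
      Filter.Eventually.of_forall fun x hx => ?_
    change D.qhat q y yo i s.1 x = ntr q i s.1 x + (D.h⁻¹ + D.τ₁ i s.1 x) *
      (tr y i s.1 x - D.Ig i s.1 x)
    rw [Data.qhat, if_pos hx]
    ring
  rw [T.bip_eq_bipInt_add_bipBd (D.qhat_mem q y yo) ψ.2, D.bipInt_qhat, h]
  simp only [map_add, map_sub, LinearMap.add_apply, LinearMap.sub_apply, T.bForm_eq]
  ring

/-- The relation between `τ₁` and `τ₂` acts only here and in `Data.bip_phat`: it rewrites the
adjoint flux with the stabilization `h⁻¹ + τ₁ - β·n`. -/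
theorem Data.bipInt_phat
    (hτ : ∀ i, ∀ s ∈ (T.cell i).halfspaces,
      ∀ᵐ x ∂((surfaceMeasure d).restrict ((T.cell i).facet s)),
        D.τ₂ i s.1 x = D.τ₁ i s.1 x - inner ℝ (D.β x) s.1)
    (p : Vh d ι k) (z : Wh d ι k) (zo : Mo T k) (ψ : T.bdryBdd) :
    T.bipInt (D.phat p z zo) ψ
      = T.bIntForm (T.bdryIncl (T.ntrL p)) ψ
        + (T.bIntForm (T.bdryMul D.stab (T.trL z)) ψ
          - T.bIntForm (T.bdryMul (T.bdryIncl D.βnE) (T.trL z)) ψ)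
        - (T.bIntForm (T.bdryMul D.stab (T.singleL zo)) ψ
          - T.bIntForm (T.bdryMul (T.bdryIncl D.βnE) (T.singleL zo)) ψ) := by
  have h : T.bipInt (D.phat p z zo) ψ
      = T.bIntForm (T.bdryIncl (T.ntrL p)
        + T.bdryMul (D.stab - T.bdryIncl D.βnE) (T.trL z - T.singleL zo)) ψ := by
    refine T.bipOn_congr isClosed_frontier.measurableSet.compl fun i s hs => ?_
    filter_upwards [hτ i s hs] with x hτx hx
    change D.phat p z zo i s.1 x = ntr p i s.1 x + (D.h⁻¹ + D.τ₁ i s.1 x - inner ℝ (D.β x) s.1) *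
      (tr z i s.1 x - single zo.toFun i s.1 x)
    rw [Data.phat, if_neg hx, hτx]
    ring
  rw [h]
  simp only [map_add, map_sub, LinearMap.add_apply, LinearMap.sub_apply]
  ring

theorem Data.bip_phat
    (hτ : ∀ i, ∀ s ∈ (T.cell i).halfspaces,
      ∀ᵐ x ∂((surfaceMeasure d).restrict ((T.cell i).facet s)),
        D.τ₂ i s.1 x = D.τ₁ i s.1 x - inner ℝ (D.β x) s.1)
    (p : Vh d ι k) (z : Wh d ι k) (zo : Mo T k) (ψ : T.bdryBdd) :
    T.bip (D.phat p z zo) ψ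
      = T.bForm (T.bdryIncl (T.ntrL p)) ψ
        + (T.bForm (T.bdryMul D.stab (T.trL z)) ψ
          - T.bForm (T.bdryMul (T.bdryIncl D.βnE) (T.trL z)) ψ)
        - (T.bIntForm (T.bdryMul D.stab (T.singleL zo)) ψ
          - T.bIntForm (T.bdryMul (T.bdryIncl D.βnE) (T.singleL zo)) ψ) := by
  have h : T.bipBd (D.phat p z zo) ψ
      = T.bBdForm (T.bdryIncl (T.ntrL p)
        + T.bdryMul (D.stab - T.bdryIncl D.βnE) (T.trL z)) ψ := by
    refine T.bipOn_congr isClosed_frontier.measurableSet fun i s hs => ?_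
    filter_upwards [hτ i s hs] with x hτx hx
    change D.phat p z zo i s.1 x = ntr p i s.1 x + (D.h⁻¹ + D.τ₁ i s.1 x - inner ℝ (D.β x) s.1) *
      tr z i s.1 x
    rw [Data.phat, if_pos hx, hτx]
    ring
  rw [T.bip_eq_bipInt_add_bipBd (D.phat_mem p z zo) ψ.2, D.bipInt_phat hτ, h]
  simp only [map_add, map_sub, LinearMap.add_apply, LinearMap.sub_apply, T.bForm_eq]
  ring

end Forms

/-! ### Linear-algebraic and analytic preliminaries -/

section Preliminaries

/-- The annihilator of `ker B` is the range of the transpose of `B`, and a functional on the dual of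
a finite-dimensional `Y` is evaluation at a vector. No constraint qualification is needed. -/
theorem exists_multiplier {X Y : Type*} [AddCommGroup X] [Module ℝ X] [AddCommGroup Y] [Module ℝ Y]
    [FiniteDimensional ℝ Y] (B : X →ₗ[ℝ] Y →ₗ[ℝ] ℝ) (c : X →ₗ[ℝ] ℝ)
    (h : ∀ δ, B δ = 0 → c δ = 0) : ∃ y, ∀ δ, c δ + B δ y = 0 := by
  have hc : c ∈ (LinearMap.ker B).dualAnnihilator := by
    rw [Submodule.mem_dualAnnihilator]
    exact fun δ hδ => h δ hδ
  rw [← LinearMap.range_dualMap_eq_dualAnnihilator_ker] at hc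
  obtain ⟨Φ, hΦ⟩ := hc
  obtain ⟨y, hy⟩ := (Module.evalEquiv ℝ Y).surjective Φ
  refine ⟨-y, fun δ => ?_⟩
  rw [← hΦ, ← hy]
  simp

/-- Linear and bilinear maps are continuous in finite dimension, and the quadratic remainder has
zero derivative at zero increment. -/
theorem hasFDerivAt_of_quadratic {V : Type*} [NormedAddCommGroup V] [NormedSpace ℝ V]
    [FiniteDimensional ℝ V] {F : V → ℝ} {x : V} (L : V →ₗ[ℝ] ℝ) (Q : V →ₗ[ℝ] V →ₗ[ℝ] ℝ)
    (h : ∀ δ, F (x + δ) = F x + L δ + Q δ δ) :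
    HasFDerivAt F (LinearMap.toContinuousLinearMap L) x := by
  let Qc : V →L[ℝ] V →L[ℝ] ℝ := LinearMap.toContinuousLinearMap
    ((LinearMap.toContinuousLinearMap : (V →ₗ[ℝ] ℝ) ≃ₗ[ℝ] (V →L[ℝ] ℝ)).toLinearMap ∘ₗ Q)
  have hF : F = fun y => F x + LinearMap.toContinuousLinearMap L (y - x)
      + Qc (y - x) (y - x) := by
    ext y
    have := h (y - x)
    rw [add_sub_cancel] at this
    exact this
  have hsub : HasFDerivAt (fun y : V => y - x) (ContinuousLinearMap.id ℝ V) x :=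
    (hasFDerivAt_id x).sub_const x
  have hlin : HasFDerivAt (fun y => F x + LinearMap.toContinuousLinearMap L (y - x))
      (LinearMap.toContinuousLinearMap L) x :=
    ((LinearMap.toContinuousLinearMap L).hasFDerivAt.comp x hsub).const_add (F x)
  have hquad := Qc.hasFDerivAt_of_bilinear hsub hsub
  rw [hF]
  refine (hlin.add hquad).congr_fderiv ?_
  ext δ
  simp

theorem eq_zero_of_forall_le_quadratic {a b : ℝ} (h : ∀ t : ℝ, 0 ≤ t * a + t ^ 2 * b) : a = 0 := by
  by_contra ha
  have hpos : 0 < |b| + 1 := by positivity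
  -- The sign is opposite to that of `a`, and the denominator exceeds `b`, so the expression becomes
  -- negative when `a ≠ 0`.
  have h1 := h (-a / (|b| + 1))
  have h2 : -a / (|b| + 1) * a + (-a / (|b| + 1)) ^ 2 * b
      = a ^ 2 / (|b| + 1) ^ 2 * (b - (|b| + 1)) := by
    field_simp
    ring
  rw [h2] at h1
  have h3 : 0 < a ^ 2 / (|b| + 1) ^ 2 := by positivity
  nlinarith [le_abs_self b]

end Preliminaries

/-! ### The bilinear form of the state equations and the Lagrangian -/

section Lagrangian

variable {d : ℕ} {Ω : Set (E d)} {ι : Type*} [Fintype ι] {T : Mesh Ω ι} (D : Data T) (k : ℕ)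

/-- The bilinear form of the discrete state equations, in the unknowns `(q, y, yo, u)` and the
test functions `(p, z, zo)`, with the signs of the Lagrangian. -/
def Data.stateForm : (Vh d ι k × Wh d ι k × Mo T k × Wh d ι k) →ₗ[ℝ]
    (Vh d ι k × Wh d ι k × Mo T k) →ₗ[ℝ] ℝ :=
  LinearMap.mk₂ ℝ (fun x m =>
    T.vipForm (T.vvalL x.1) (T.vvalL m.1) - T.ipForm (T.valL x.2.1) (T.divL m.1)
    + T.bIntForm (T.bdryIncl (T.singleL x.2.2.1)) (T.ntrL m.1)
    + T.vipForm (T.vvalL x.1) (T.gradL m.2.1) + T.vipForm (D.βmulL x.2.1) (T.gradL m.2.1)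
    + T.ipForm (D.divβL x.2.1) (T.valL m.2.1) - T.bForm (T.bdryIncl (T.ntrL x.1)) (T.trL m.2.1)
    - T.bForm (T.bdryMul D.stab (T.trL x.2.1)) (T.trL m.2.1)
    - T.bIntForm (T.bdryMul (T.bdryIncl D.βnE) (T.singleL x.2.2.1)) (T.trL m.2.1)
    + T.bIntForm (T.bdryMul D.stab (T.singleL x.2.2.1)) (T.trL m.2.1)
    + T.ipForm (T.valL x.2.2.2) (T.valL m.2.1)
    + T.bIntForm (T.bdryIncl (T.ntrL x.1)) (T.singleL m.2.2)
    + T.bIntForm (T.bdryMul D.stab (T.trL x.2.1)) (T.singleL m.2.2)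
    - T.bIntForm (T.bdryMul D.stab (T.singleL x.2.2.1)) (T.singleL m.2.2))
    (fun x x' m => by
      simp only [Prod.fst_add, Prod.snd_add, map_add, LinearMap.add_apply]
      ring)
    (fun c x m => by
      simp only [Prod.smul_fst, Prod.smul_snd, map_smul, LinearMap.smul_apply, smul_eq_mul]
      ring)
    (fun x m m' => by
      simp only [Prod.fst_add, Prod.snd_add, map_add]
      ring)
    (fun c x m => by
      simp only [Prod.smul_fst, Prod.smul_snd, map_smul, smul_eq_mul]
      ring)

/-- The data of the discrete state equations, with the signs of the Lagrangian. -/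
def Data.stateLoad (p : Vh d ι k) (z : Wh d ι k) : ℝ :=
  T.bBdForm (T.bdryIncl D.IgE) (T.ntrL p)
    - T.bBdForm (T.bdryMul (T.bdryIncl D.βnE) D.IgE) (T.trL z)
    + T.bBdForm (T.bdryMul D.stab D.IgE) (T.trL z) + T.ipForm D.fE (T.valL z)

/-- The derivative of the cost functional. -/
def Data.costDeriv (y u : Wh d ι k) : (Vh d ι k × Wh d ι k × Mo T k × Wh d ι k) →ₗ[ℝ] ℝ where
  toFun δ := T.ipForm (T.valL y - D.ydE) (T.valL δ.2.1)
    + D.γ * T.ipForm (T.valL u) (T.valL δ.2.2.2)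
  map_add' a b := by
    simp only [Prod.fst_add, Prod.snd_add, map_add]
    ring
  map_smul' c a := by
    simp only [Prod.smul_fst, Prod.smul_snd, map_smul, smul_eq_mul, RingHom.id_apply]
    ring

variable {k}

theorem Data.stateForm_apply (q : Vh d ι k) (y : Wh d ι k) (yo : Mo T k) (u : Wh d ι k)
    (p : Vh d ι k) (z : Wh d ι k) (zo : Mo T k) :
    D.stateForm k (q, y, yo, u) (p, z, zo) =
      T.vipForm (T.vvalL q) (T.vvalL p) - T.ipForm (T.valL y) (T.divL p)
      + T.bIntForm (T.bdryIncl (T.singleL yo)) (T.ntrL p)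
      + T.vipForm (T.vvalL q) (T.gradL z) + T.vipForm (D.βmulL y) (T.gradL z)
      + T.ipForm (D.divβL y) (T.valL z) - T.bForm (T.bdryIncl (T.ntrL q)) (T.trL z)
      - T.bForm (T.bdryMul D.stab (T.trL y)) (T.trL z)
      - T.bIntForm (T.bdryMul (T.bdryIncl D.βnE) (T.singleL yo)) (T.trL z)
      + T.bIntForm (T.bdryMul D.stab (T.singleL yo)) (T.trL z)
      + T.ipForm (T.valL u) (T.valL z)
      + T.bIntForm (T.bdryIncl (T.ntrL q)) (T.singleL zo)
      + T.bIntForm (T.bdryMul D.stab (T.trL y)) (T.singleL zo)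
      - T.bIntForm (T.bdryMul D.stab (T.singleL yo)) (T.singleL zo) := rfl

theorem ipForm_comm (a b : T.L2) : T.ipForm a b = T.ipForm b a := by
  change T.ip _ _ = T.ip _ _
  simp only [Mesh.ip, mul_comm]

theorem vipForm_comm (a b : T.VL2) : T.vipForm a b = T.vipForm b a := by
  change T.vip _ _ = T.vip _ _
  simp only [Mesh.vip, real_inner_comm]

theorem bipForm_incl_comm (S : Set (E d)) (a b : T.bdryBdd) :
    T.bipForm S (T.bdryIncl a) b = T.bipForm S (T.bdryIncl b) a :=
  T.bipOn_comm S a b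

theorem bipForm_mul_right_comm (S : Set (E d)) (c : T.bdryInt) (a b : T.bdryBdd) :
    T.bipForm S (T.bdryMul c a) b = T.bipForm S (T.bdryMul c b) a := by
  change T.bipOn S (c * a) b = T.bipOn S (c * b) a
  simp only [Mesh.bipOn, Pi.mul_apply, mul_right_comm]

theorem ipForm_self_nonneg (a : T.L2) : 0 ≤ T.ipForm a a :=
  Finset.sum_nonneg fun _ _ => integral_nonneg fun _ => mul_self_nonneg _

theorem Data.cost_eq (y u : Wh d ι k) :
    D.cost y u = 1 / 2 * T.ipForm (T.valL y - D.ydE) (T.valL y - D.ydE)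
      + D.γ / 2 * T.ipForm (T.valL u) (T.valL u) := rfl

theorem Data.cost_add (y u w v : Wh d ι k) (r : Vh d ι k) (μ : Mo T k) :
    D.cost (y + w) (u + v) = D.cost y u + D.costDeriv k y u (r, w, μ, v)
      + (1 / 2 * T.ipForm (T.valL w) (T.valL w) + D.γ / 2 * T.ipForm (T.valL v) (T.valL v)) := by
  rw [D.cost_eq, D.cost_eq]
  change _ = _ + (T.ipForm (T.valL y - D.ydE) (T.valL w)
    + D.γ * T.ipForm (T.valL u) (T.valL v)) + _
  have h1 := ipForm_comm (T.valL w) (T.valL y - D.ydE)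
  have h2 := ipForm_comm (T.valL v) (T.valL u)
  simp only [map_add, map_sub, LinearMap.add_apply, LinearMap.sub_apply] at h1 ⊢
  rw [h2]
  linear_combination (1 / 2 : ℝ) * h1

theorem Data.lagrangian_eq (q : Vh d ι k) (y : Wh d ι k) (yo : Mo T k) (u : Wh d ι k)
    (p : Vh d ι k) (z : Wh d ι k) (zo : Mo T k) :
    D.lagrangian q y yo u p z zo
      = D.cost y u + D.stateForm k (q, y, yo, u) (p, z, zo) + D.stateLoad k p z := by
  rw [D.stateForm_apply]
  -- The bundled forms unfold to the raw pairings, so only the grouping of `β·n - h⁻¹ - τ₁` has to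
  -- be changed.
  have h1 : D.lagrangian q y yo u p z zo = D.cost y u
      + T.vipForm (T.vvalL q) (T.vvalL p) - T.ipForm (T.valL y) (T.divL p)
      + T.bIntForm (T.bdryIncl (T.singleL yo)) (T.ntrL p)
      + T.bBdForm (T.bdryIncl D.IgE) (T.ntrL p)
      + T.vipForm (T.vvalL q + D.βmulL y) (T.gradL z) + T.ipForm (D.divβL y) (T.valL z)
      - T.bForm (T.bdryIncl (T.ntrL q)) (T.trL z)
      - T.bForm (T.bdryMul D.stab (T.trL y)) (T.trL z)
      - T.bIntForm (T.bdryMul (T.bdryIncl D.βnE - D.stab) (T.singleL yo)) (T.trL z)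
      + T.ipForm (T.valL u) (T.valL z)
      - T.bBdForm (T.bdryMul (T.bdryIncl D.βnE - D.stab) D.IgE) (T.trL z)
      + T.ipForm D.fE (T.valL z)
      + T.bIntForm (T.bdryIncl (T.ntrL q) + T.bdryMul D.stab (T.trL y - T.singleL yo))
          (T.singleL zo) := by
    rw [Data.lagrangian, sub_sub D.βn]
    rfl
  rw [h1, Data.stateLoad]
  simp only [map_add, map_sub, LinearMap.add_apply, LinearMap.sub_apply]
  ring

/-- Three equations with independent test functions are one equation on the product test space. It
shows the feasible set to be invariant under translation by the kernel of `stateForm`. -/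
theorem Data.doState_iff (q : Vh d ι k) (y : Wh d ι k) (yo : Mo T k) (u : Wh d ι k) :
    D.DOState q y yo u ↔ ∀ p z zo, D.stateForm k (q, y, yo, u) (p, z, zo)
      + D.stateLoad k p z = 0 := by
  have hflux : ∀ r : Vh d ι k,
      (T.vip (vval q) (vval r) - T.ip (val y) (div r) + T.bipInt (single yo.toFun) (ntr r)
        = -T.bipBd D.Ig (ntr r)) ↔
      D.stateForm k (q, y, yo, u) (r, 0, 0) + D.stateLoad k r 0 = 0 := by
    intro r
    have h1 : T.vip (vval q) (vval r) - T.ip (val y) (div r) + T.bipInt (single yo.toFun) (ntr r)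
        = T.vipForm (T.vvalL q) (T.vvalL r) - T.ipForm (T.valL y) (T.divL r)
          + T.bIntForm (T.bdryIncl (T.singleL yo)) (T.ntrL r) := rfl
    have h2 : T.bipBd D.Ig (ntr r) = T.bBdForm (T.bdryIncl D.IgE) (T.ntrL r) := rfl
    rw [h1, h2, D.stateForm_apply, Data.stateLoad, ← sub_eq_zero, ← eq_iff_iff]
    congr 1
    simp only [map_zero]
    ring
  have hstate : ∀ w : Wh d ι k,
      (-T.vip (vval q + D.βmul y) (grad w) - T.ip (D.divβ y) (val w) + T.bip (ntr q) (tr w)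
        + T.bip ((D.hinv + D.τ₁) * tr y) (tr w)
        + T.bipInt ((D.βn - (D.hinv + D.τ₁)) * single yo.toFun) (tr w) - T.ip (val u) (val w)
        = -T.bipBd ((D.βn - (D.hinv + D.τ₁)) * D.Ig) (tr w) + T.ip D.fc (val w)) ↔
      D.stateForm k (q, y, yo, u) (0, w, 0) + D.stateLoad k 0 w = 0 := by
    intro w
    have h1 : -T.vip (vval q + D.βmul y) (grad w) - T.ip (D.divβ y) (val w) + T.bip (ntr q) (tr w)
        + T.bip ((D.hinv + D.τ₁) * tr y) (tr w)
        + T.bipInt ((D.βn - (D.hinv + D.τ₁)) * single yo.toFun) (tr w) - T.ip (val u) (val w)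
        = -T.vipForm (T.vvalL q + D.βmulL y) (T.gradL w) - T.ipForm (D.divβL y) (T.valL w)
          + T.bForm (T.bdryIncl (T.ntrL q)) (T.trL w)
          + T.bForm (T.bdryMul D.stab (T.trL y)) (T.trL w)
          + T.bIntForm (T.bdryMul (T.bdryIncl D.βnE - D.stab) (T.singleL yo)) (T.trL w)
          - T.ipForm (T.valL u) (T.valL w) := rfl
    have h2 : -T.bipBd ((D.βn - (D.hinv + D.τ₁)) * D.Ig) (tr w) + T.ip D.fc (val w)
        = -T.bBdForm (T.bdryMul (T.bdryIncl D.βnE - D.stab) D.IgE) (T.trL w)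
          + T.ipForm D.fE (T.valL w) := rfl
    -- The second state equation enters the Lagrangian with a minus sign.
    rw [h1, h2, D.stateForm_apply, Data.stateLoad, ← sub_eq_zero, ← neg_eq_zero, ← eq_iff_iff]
    congr 1
    simp only [map_zero, map_add, map_sub, LinearMap.add_apply, LinearMap.sub_apply]
    ring
  have htrace : ∀ μ : Mo T k,
      (T.bipInt (ntr q + (D.hinv + D.τ₁) * (tr y - single yo.toFun)) (single μ.toFun) = 0) ↔
      D.stateForm k (q, y, yo, u) (0, 0, μ) + D.stateLoad k 0 0 = 0 := by
    intro μ
    have h1 : T.bipInt (ntr q + (D.hinv + D.τ₁) * (tr y - single yo.toFun)) (single μ.toFun)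
        = T.bIntForm (T.bdryIncl (T.ntrL q) + T.bdryMul D.stab (T.trL y - T.singleL yo))
          (T.singleL μ) := rfl
    rw [h1, D.stateForm_apply, Data.stateLoad, ← eq_iff_iff]
    congr 1
    simp only [map_zero, map_add, map_sub, LinearMap.add_apply, LinearMap.sub_apply]
    ring
  constructor
  · rintro ⟨h1, h2, h3⟩ p z zo
    have e1 := (hflux p).1 (h1 p)
    have e2 := (hstate z).1 (h2 z)
    have e3 := (htrace zo).1 (h3 zo)
    rw [D.stateForm_apply, Data.stateLoad] at e1 e2 e3 ⊢
    simp only [map_zero] at e1 e2 e3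
    linear_combination e1 + e2 + e3
  · intro h
    exact ⟨fun r => (hflux r).2 (h r 0 0), fun w => (hstate w).2 (h 0 w 0),
      fun μ => (htrace μ).2 (h 0 0 μ)⟩

end Lagrangian

/-! ### Comparison of the two approaches -/

section Comparison

variable {d : ℕ} {Ω : Set (E d)} {ι : Type*} [Fintype ι] {T : Mesh Ω ι} (D : Data T) {k : ℕ}

/-- The derivative of the Lagrangian with respect to all primal variables. -/
def Data.lagrangianDeriv (y u : Wh d ι k) (m : Vh d ι k × Wh d ι k × Mo T k) :
    (Vh d ι k × Wh d ι k × Mo T k × Wh d ι k) →ₗ[ℝ] ℝ :=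
  D.costDeriv k y u + (D.stateForm k).flip m

theorem Data.lagrangian_add (q r : Vh d ι k) (y w : Wh d ι k) (yo μ : Mo T k) (u v : Wh d ι k)
    (p : Vh d ι k) (z : Wh d ι k) (zo : Mo T k) :
    D.lagrangian (q + r) (y + w) (yo + μ) (u + v) p z zo
      = D.lagrangian q y yo u p z zo + D.lagrangianDeriv y u (p, z, zo) (r, w, μ, v)
        + (1 / 2 * T.ipForm (T.valL w) (T.valL w)
          + D.γ / 2 * T.ipForm (T.valL v) (T.valL v)) := by
  have h : ((q + r, y + w, yo + μ, u + v) : Vh d ι k × Wh d ι k × Mo T k × Wh d ι k)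
      = (q, y, yo, u) + (r, w, μ, v) := rfl
  rw [D.lagrangian_eq, D.lagrangian_eq, D.cost_add y u w v r μ, h, map_add, LinearMap.add_apply,
    Data.lagrangianDeriv, LinearMap.add_apply, LinearMap.flip_apply]
  ring

/-- Green's formula turns `(r, ∇z) - ⟨r·n, z⟩` into `-(z, ∇·r)`. -/
theorem Data.lagrangianDeriv_flux (y u : Wh d ι k) (p : Vh d ι k) (z : Wh d ι k) (zo : Mo T k)
    (r : Vh d ι k) :
    D.lagrangianDeriv y u (p, z, zo) (r, 0, 0, 0) = odAdjFlux p z zo r := by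
  have h1 : D.lagrangianDeriv y u (p, z, zo) (r, 0, 0, 0)
      = T.ipForm (T.valL y - D.ydE) (T.valL 0) + D.γ * T.ipForm (T.valL u) (T.valL 0)
        + D.stateForm k (r, 0, 0, 0) (p, z, zo) := rfl
  have h2 : odAdjFlux p z zo r = T.vipForm (T.vvalL p) (T.vvalL r)
      - T.ipForm (T.valL z) (T.divL r) + T.bIntForm (T.bdryIncl (T.singleL zo)) (T.ntrL r) := rfl
  have h3 : T.vipForm (T.vvalL r) (T.gradL z) + T.ipForm (T.valL z) (T.divL r)
      = T.bForm (T.bdryIncl (T.ntrL r)) (T.trL z) := T.vip_vval_grad r z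
  rw [h1, h2, D.stateForm_apply, vipForm_comm (T.vvalL p), bipForm_incl_comm _ (T.singleL zo)]
  simp only [map_zero, LinearMap.zero_apply]
  linear_combination h3

/-- Both Green formulas are used: for `p` against `w`, and for `β` against `w z`. The resulting
`⟨β·n w, z⟩` is absorbed in the stabilization of `p̂·n`. -/
theorem Data.lagrangianDeriv_state
    (hτ : ∀ i, ∀ s ∈ (T.cell i).halfspaces,
      ∀ᵐ x ∂((surfaceMeasure d).restrict ((T.cell i).facet s)),
        D.τ₂ i s.1 x = D.τ₁ i s.1 x - inner ℝ (D.β x) s.1)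
    (y u : Wh d ι k) (p : Vh d ι k) (z : Wh d ι k) (zo : Mo T k) (w : Wh d ι k) :
    D.lagrangianDeriv y u (p, z, zo) (0, w, 0, 0) = -D.odAdjState y p z zo w := by
  have h1 : D.lagrangianDeriv y u (p, z, zo) (0, w, 0, 0)
      = T.ipForm (T.valL y - D.ydE) (T.valL w) + D.γ * T.ipForm (T.valL u) (T.valL 0)
        + D.stateForm k (0, w, 0, 0) (p, z, zo) := rfl
  have h2 : D.odAdjState y p z zo w = (-T.vipForm (T.vvalL p - D.βmulL z) (T.gradL w)
      + T.bip (D.phat p z zo) (T.trL w)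
      - T.bIntForm (T.bdryMul (T.bdryIncl D.βnE) (T.singleL zo)) (T.trL w)
      - T.ipForm (T.valL y) (T.valL w)) - -T.ipForm D.ydE (T.valL w) := rfl
  have h3 : T.vipForm (T.vvalL p) (T.gradL w) + T.ipForm (T.valL w) (T.divL p)
      = T.bForm (T.bdryIncl (T.ntrL p)) (T.trL w) := T.vip_vval_grad p w
  have h4 : T.vipForm (D.βmulL w) (T.gradL z) + T.vipForm (D.βmulL z) (T.gradL w)
      + T.ipForm (D.divβL w) (T.valL z)
      = T.bForm (T.bdryMul (T.bdryIncl D.βnE) (T.trL w)) (T.trL z) := D.vip_βmul_grad w z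
  rw [bipForm_mul_right_comm] at h4
  rw [h1, h2, D.stateForm_apply, D.bip_phat hτ, bipForm_mul_right_comm _ D.stab (T.trL w) (T.trL z),
    bipForm_mul_right_comm _ D.stab (T.trL w) (T.singleL zo)]
  simp only [map_zero, map_sub, LinearMap.zero_apply, LinearMap.sub_apply]
  linear_combination h4 - h3

/-- No integration by parts is needed: the shift by `β·n` in the stabilization produces a `β·n ẑ`
that cancels the explicit one. -/
theorem Data.lagrangianDeriv_trace
    (hτ : ∀ i, ∀ s ∈ (T.cell i).halfspaces,
      ∀ᵐ x ∂((surfaceMeasure d).restrict ((T.cell i).facet s)),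
        D.τ₂ i s.1 x = D.τ₁ i s.1 x - inner ℝ (D.β x) s.1)
    (y u : Wh d ι k) (p : Vh d ι k) (z : Wh d ι k) (zo : Mo T k) (μ : Mo T k) :
    D.lagrangianDeriv y u (p, z, zo) (0, 0, μ, 0) = D.odAdjTrace p z zo μ := by
  have h1 : D.lagrangianDeriv y u (p, z, zo) (0, 0, μ, 0)
      = T.ipForm (T.valL y - D.ydE) (T.valL 0) + D.γ * T.ipForm (T.valL u) (T.valL 0)
        + D.stateForm k (0, 0, μ, 0) (p, z, zo) := rfl
  have h2 : D.odAdjTrace p z zo μ = T.bIntForm (⟨D.phat p z zo, D.phat_mem p z zo⟩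
      - T.bdryMul (T.bdryIncl D.βnE) (T.singleL zo)) (T.singleL μ) := rfl
  have h3 : T.bIntForm ⟨D.phat p z zo, D.phat_mem p z zo⟩ (T.singleL μ)
      = T.bipInt (D.phat p z zo) (T.singleL μ) := rfl
  rw [h1, h2, (T.bIntForm).map_sub, LinearMap.sub_apply, h3, D.bipInt_phat hτ, D.stateForm_apply,
    bipForm_incl_comm _ (T.ntrL p), bipForm_mul_right_comm _ D.stab (T.trL z),
    bipForm_mul_right_comm _ _ (T.trL z), bipForm_mul_right_comm _ _ (T.singleL zo)]
  simp only [map_zero, LinearMap.zero_apply]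
  ring

theorem Data.lagrangianDeriv_control (y u : Wh d ι k) (p : Vh d ι k) (z : Wh d ι k) (zo : Mo T k)
    (v : Wh d ι k) :
    D.lagrangianDeriv y u (p, z, zo) (0, 0, 0, v) = D.odControl u z v := by
  have h1 : D.lagrangianDeriv y u (p, z, zo) (0, 0, 0, v)
      = T.ipForm (T.valL y - D.ydE) (T.valL 0) + D.γ * T.ipForm (T.valL u) (T.valL v)
        + D.stateForm k (0, 0, 0, v) (p, z, zo) := rfl
  have h2 : D.odControl u z v = T.ipForm (T.valL z + D.γ • T.valL u) (T.valL v) := rfl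
  rw [h1, h2, D.stateForm_apply, ipForm_comm (T.valL v)]
  simp only [map_zero, map_add, map_smul, LinearMap.zero_apply, LinearMap.add_apply,
    LinearMap.smul_apply, smul_eq_mul]
  ring

theorem Data.lagrangianDeriv_apply
    (hτ : ∀ i, ∀ s ∈ (T.cell i).halfspaces,
      ∀ᵐ x ∂((surfaceMeasure d).restrict ((T.cell i).facet s)),
        D.τ₂ i s.1 x = D.τ₁ i s.1 x - inner ℝ (D.β x) s.1)
    (y u : Wh d ι k) (p : Vh d ι k) (z : Wh d ι k) (zo : Mo T k)
    (r : Vh d ι k) (w : Wh d ι k) (μ : Mo T k) (v : Wh d ι k) :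
    D.lagrangianDeriv y u (p, z, zo) (r, w, μ, v)
      = odAdjFlux p z zo r - D.odAdjState y p z zo w + D.odAdjTrace p z zo μ
        + D.odControl u z v := by
  have h : ((r, w, μ, v) : Vh d ι k × Wh d ι k × Mo T k × Wh d ι k)
      = (r, 0, 0, 0) + (0, w, 0, 0) + (0, 0, μ, 0) + (0, 0, 0, v) := by
    simp
  rw [h, map_add, map_add, map_add, D.lagrangianDeriv_flux, D.lagrangianDeriv_state hτ,
    D.lagrangianDeriv_trace hτ, D.lagrangianDeriv_control]
  ring

theorem Data.hasFDerivAt_lagrangian_flux (q : Vh d ι k) (y : Wh d ι k) (yo : Mo T k) (u : Wh d ι k)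
    (p : Vh d ι k) (z : Wh d ι k) (zo : Mo T k) :
    ∃ L : Vh d ι k →L[ℝ] ℝ, HasFDerivAt (fun q' => D.lagrangian q' y yo u p z zo) L q ∧
      ∀ r, L r = odAdjFlux p z zo r := by
  refine ⟨_, hasFDerivAt_of_quadratic (D.lagrangianDeriv y u (p, z, zo) ∘ₗ LinearMap.inl ℝ _ _) 0
    fun r => ?_, fun r => D.lagrangianDeriv_flux y u p z zo r⟩
  have h := D.lagrangian_add q r y 0 yo 0 u 0 p z zo
  have e : ((r, 0, 0, 0) : Vh d ι k × Wh d ι k × Mo T k × Wh d ι k) = LinearMap.inl ℝ _ _ r := rfl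
  rw [e] at h
  simpa using h

theorem Data.hasFDerivAt_lagrangian_state
    (hτ : ∀ i, ∀ s ∈ (T.cell i).halfspaces,
      ∀ᵐ x ∂((surfaceMeasure d).restrict ((T.cell i).facet s)),
        D.τ₂ i s.1 x = D.τ₁ i s.1 x - inner ℝ (D.β x) s.1)
    (q : Vh d ι k) (y : Wh d ι k) (yo : Mo T k) (u : Wh d ι k)
    (p : Vh d ι k) (z : Wh d ι k) (zo : Mo T k) :
    ∃ L : Wh d ι k →L[ℝ] ℝ, HasFDerivAt (fun y' => D.lagrangian q y' yo u p z zo) L y ∧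
      ∀ w, L w = -D.odAdjState y p z zo w := by
  refine ⟨_, hasFDerivAt_of_quadratic
    (D.lagrangianDeriv y u (p, z, zo) ∘ₗ LinearMap.inr ℝ _ _ ∘ₗ LinearMap.inl ℝ _ _)
    ((1 / 2 : ℝ) • T.ipForm.compl₁₂ T.valL T.valL)
    fun w => ?_, fun w => D.lagrangianDeriv_state hτ y u p z zo w⟩
  have h := D.lagrangian_add q 0 y w yo 0 u 0 p z zo
  have e : ((0, w, 0, 0) : Vh d ι k × Wh d ι k × Mo T k × Wh d ι k)
    = LinearMap.inr ℝ _ _ (LinearMap.inl ℝ _ _ w) := rfl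
  rw [e] at h
  simpa using h

theorem Data.hasFDerivAt_lagrangian_trace
    (hτ : ∀ i, ∀ s ∈ (T.cell i).halfspaces,
      ∀ᵐ x ∂((surfaceMeasure d).restrict ((T.cell i).facet s)),
        D.τ₂ i s.1 x = D.τ₁ i s.1 x - inner ℝ (D.β x) s.1)
    (q : Vh d ι k) (y : Wh d ι k) (yo : Mo T k) (u : Wh d ι k)
    (p : Vh d ι k) (z : Wh d ι k) (zo : Mo T k) :
    ∃ L : Mo T k →L[ℝ] ℝ, HasFDerivAt (fun yo' => D.lagrangian q y yo' u p z zo) L yo ∧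
      ∀ μ, L μ = D.odAdjTrace p z zo μ := by
  refine ⟨_, hasFDerivAt_of_quadratic (D.lagrangianDeriv y u (p, z, zo) ∘ₗ
    LinearMap.inr ℝ _ _ ∘ₗ LinearMap.inr ℝ _ _ ∘ₗ LinearMap.inl ℝ _ _) 0
    fun μ => ?_, fun μ => D.lagrangianDeriv_trace hτ y u p z zo μ⟩
  simpa using D.lagrangian_add q 0 y 0 yo μ u 0 p z zo

theorem Data.hasFDerivAt_lagrangian_control (q : Vh d ι k) (y : Wh d ι k) (yo : Mo T k)
    (u : Wh d ι k) (p : Vh d ι k) (z : Wh d ι k) (zo : Mo T k) :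
    ∃ L : Wh d ι k →L[ℝ] ℝ, HasFDerivAt (fun u' => D.lagrangian q y yo u' p z zo) L u ∧
      ∀ w, L w = D.odControl u z w := by
  refine ⟨_, hasFDerivAt_of_quadratic (D.lagrangianDeriv y u (p, z, zo) ∘ₗ
    LinearMap.inr ℝ _ _ ∘ₗ LinearMap.inr ℝ _ _ ∘ₗ LinearMap.inr ℝ _ _)
    ((D.γ / 2) • T.ipForm.compl₁₂ T.valL T.valL)
    fun v => ?_, fun v => D.lagrangianDeriv_control y u p z zo v⟩
  simpa using D.lagrangian_add q 0 y 0 yo 0 u v p z zo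

/-- The discrete state equations of the two approaches coincide. -/
theorem Data.doState_iff_od (hΩ : IsOpen Ω) (q : Vh d ι k) (y : Wh d ι k) (yo : Mo T k)
    (u : Wh d ι k) :
    D.DOState q y yo u ↔
      (∀ r : Vh d ι k,
        T.vip (vval q) (vval r) - T.ip (val y) (div r) + T.bipInt (single yo.toFun) (ntr r)
          = -T.bipBd D.Ig (ntr r)) ∧
      (∀ w : Wh d ι k,
        -T.vip (vval q + D.βmul y) (grad w) - T.ip (D.divβ y) (val w)
          + T.bip (D.qhat q y yo) (tr w) + T.bipInt (D.βn * single yo.toFun) (tr w)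
          - T.ip (val u) (val w)
          = -T.bipBd (D.βn * D.Ig) (tr w) + T.ip D.fc (val w)) ∧
      (∀ μ : Mo T k,
        T.bipInt (D.qhat q y yo + D.βn * single yo.toFun) (single μ.toFun) = 0) := by
  have hstate : ∀ w : Wh d ι k,
      (-T.vip (vval q + D.βmul y) (grad w) - T.ip (D.divβ y) (val w) + T.bip (ntr q) (tr w)
        + T.bip ((D.hinv + D.τ₁) * tr y) (tr w)
        + T.bipInt ((D.βn - (D.hinv + D.τ₁)) * single yo.toFun) (tr w) - T.ip (val u) (val w)
        = -T.bipBd ((D.βn - (D.hinv + D.τ₁)) * D.Ig) (tr w) + T.ip D.fc (val w)) ↔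
      (-T.vip (vval q + D.βmul y) (grad w) - T.ip (D.divβ y) (val w)
          + T.bip (D.qhat q y yo) (tr w) + T.bipInt (D.βn * single yo.toFun) (tr w)
          - T.ip (val u) (val w)
          = -T.bipBd (D.βn * D.Ig) (tr w) + T.ip D.fc (val w)) := by
    intro w
    have e1 : T.bip (D.qhat q y yo) (tr w) = _ := D.bip_qhat q y yo (T.trL w)
    have e2 : T.bipInt ((D.βn - (D.hinv + D.τ₁)) * single yo.toFun) (tr w)
      = T.bIntForm (T.bdryMul (T.bdryIncl D.βnE - D.stab) (T.singleL yo)) (T.trL w) := rfl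
    have e3 : T.bipBd ((D.βn - (D.hinv + D.τ₁)) * D.Ig) (tr w)
      = T.bBdForm (T.bdryMul (T.bdryIncl D.βnE - D.stab) D.IgE) (T.trL w) := rfl
    have e4 : T.bip (ntr q) (tr w) = T.bForm (T.bdryIncl (T.ntrL q)) (T.trL w) := rfl
    have e5 : T.bip ((D.hinv + D.τ₁) * tr y) (tr w)
      = T.bForm (T.bdryMul D.stab (T.trL y)) (T.trL w) := rfl
    have e6 : T.bipInt (D.βn * single yo.toFun) (tr w)
      = T.bIntForm (T.bdryMul (T.bdryIncl D.βnE) (T.singleL yo)) (T.trL w) := rfl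
    have e7 : T.bipBd (D.βn * D.Ig) (tr w)
      = T.bBdForm (T.bdryMul (T.bdryIncl D.βnE) D.IgE) (T.trL w) := rfl
    rw [e1, e2, e3, e4, e5, e6, e7]
    simp only [map_sub, LinearMap.sub_apply]
    constructor <;> intro h <;> linear_combination h
  -- Unlike the element equation, which is a regrouping, this equation needs the cancellation of
  -- `β·n ŷ` across interior faces.
  have htrace : ∀ μ : Mo T k,
      T.bipInt (ntr q + (D.hinv + D.τ₁) * (tr y - single yo.toFun)) (single μ.toFun)
        = T.bipInt (D.qhat q y yo + D.βn * single yo.toFun) (single μ.toFun) := by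
    intro μ
    have e1 : T.bipInt (ntr q + (D.hinv + D.τ₁) * (tr y - single yo.toFun)) (single μ.toFun)
        = T.bIntForm (T.bdryIncl (T.ntrL q) + T.bdryMul D.stab (T.trL y - T.singleL yo))
          (T.singleL μ) := rfl
    have e2 : T.bipInt (D.qhat q y yo + D.βn * single yo.toFun) (single μ.toFun)
        = T.bIntForm (⟨D.qhat q y yo, D.qhat_mem q y yo⟩
          + T.bdryMul (T.bdryIncl D.βnE) (T.singleL yo)) (T.singleL μ) := rfl
    have e3 : T.bIntForm ⟨D.qhat q y yo, D.qhat_mem q y yo⟩ (T.singleL μ)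
        = T.bipInt (D.qhat q y yo) (T.singleL μ) := rfl
    have e4 : T.bIntForm (T.bdryMul (T.bdryIncl D.βnE) (T.singleL yo)) (T.singleL μ) = 0 :=
      D.bipInt_βn_single_eq_zero hΩ yo μ
    rw [e1, e2]
    simp only [map_add, map_sub, LinearMap.add_apply, LinearMap.sub_apply, e3, e4, D.bipInt_qhat]
    ring
  constructor
  · rintro ⟨h1, h2, h3⟩
    exact ⟨h1, fun w => (hstate w).1 (h2 w), fun μ => (htrace μ).symm.trans (h3 μ)⟩
  · rintro ⟨h1, h2, h3⟩
    exact ⟨h1, fun w => (hstate w).2 (h2 w), fun μ => (htrace μ).trans (h3 μ)⟩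

theorem Data.odSystem_iff (hΩ : IsOpen Ω) (q : Vh d ι k) (y : Wh d ι k) (yo : Mo T k) (u : Wh d ι k)
    (p : Vh d ι k) (z : Wh d ι k) (zo : Mo T k) :
    D.ODSystem q y yo u p z zo ↔ D.DOState q y yo u ∧
      (∀ r : Vh d ι k, odAdjFlux p z zo r = 0) ∧ (∀ w : Wh d ι k, D.odAdjState y p z zo w = 0) ∧
      (∀ μ : Mo T k, D.odAdjTrace p z zo μ = 0) ∧ (∀ w : Wh d ι k, D.odControl u z w = 0) := by
  rw [D.doState_iff_od hΩ]
  constructor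
  · rintro ⟨h1, h2, h3, h4, h5, h6, h7⟩
    exact ⟨⟨h1, h2, h3⟩, h4, h5, h6, h7⟩
  · rintro ⟨⟨h1, h2, h3⟩, h4, h5, h6, h7⟩
    exact ⟨h1, h2, h3, h4, h5, h6, h7⟩

theorem hasFDerivAt_zero_iff {V : Type*} [NormedAddCommGroup V] [NormedSpace ℝ V] {F : V → ℝ}
    {x : V} {A : V → ℝ} (h : ∃ L : V →L[ℝ] ℝ, HasFDerivAt F L x ∧ ∀ v, L v = A v) :
    HasFDerivAt F (0 : V →L[ℝ] ℝ) x ↔ ∀ v, A v = 0 := by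
  obtain ⟨L, hL, hA⟩ := h
  constructor
  · intro h0 v
    rw [← hA, hL.unique h0]
    rfl
  · intro h0
    have : L = 0 := by
      ext v
      rw [hA, h0]
      rfl
    rwa [← this]

theorem Data.doSystem_iff_odSystem (hΩ : IsOpen Ω)
    (hτ : ∀ i, ∀ s ∈ (T.cell i).halfspaces,
      ∀ᵐ x ∂((surfaceMeasure d).restrict ((T.cell i).facet s)),
        D.τ₂ i s.1 x = D.τ₁ i s.1 x - inner ℝ (D.β x) s.1)
    (q : Vh d ι k) (y : Wh d ι k) (yo : Mo T k) (u : Wh d ι k)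
    (p : Vh d ι k) (z : Wh d ι k) (zo : Mo T k) :
    D.DOSystem q y yo u p z zo ↔ D.ODSystem q y yo u p z zo := by
  have e1 := hasFDerivAt_zero_iff (D.hasFDerivAt_lagrangian_flux q y yo u p z zo)
  have e2 := hasFDerivAt_zero_iff (D.hasFDerivAt_lagrangian_state hτ q y yo u p z zo)
  have e3 := hasFDerivAt_zero_iff (D.hasFDerivAt_lagrangian_trace hτ q y yo u p z zo)
  have e4 := hasFDerivAt_zero_iff (D.hasFDerivAt_lagrangian_control q y yo u p z zo)
  simp only [neg_eq_zero] at e2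
  rw [D.odSystem_iff hΩ, ← e1, ← e2, ← e3, ← e4]
  constructor
  · rintro ⟨h1, h2, h3, h4, h5⟩
    exact ⟨h1, h2, h3, h4, h5⟩
  · rintro ⟨h1, h2, h3, h4, h5⟩
    exact ⟨h1, h2, h3, h4, h5⟩

/-- Merges the four adjoint and optimality equations into the vanishing of one functional on the
product space, the form in which `exists_multiplier` delivers its result. -/
theorem Data.odSystem_iff_lagrangianDeriv (hΩ : IsOpen Ω)
    (hτ : ∀ i, ∀ s ∈ (T.cell i).halfspaces,
      ∀ᵐ x ∂((surfaceMeasure d).restrict ((T.cell i).facet s)),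
        D.τ₂ i s.1 x = D.τ₁ i s.1 x - inner ℝ (D.β x) s.1)
    (q : Vh d ι k) (y : Wh d ι k) (yo : Mo T k) (u : Wh d ι k)
    (p : Vh d ι k) (z : Wh d ι k) (zo : Mo T k) :
    D.ODSystem q y yo u p z zo ↔
      D.DOState q y yo u ∧ ∀ δ, D.lagrangianDeriv y u (p, z, zo) δ = 0 := by
  rw [D.odSystem_iff hΩ]
  refine and_congr_right fun _ => ⟨?_, fun h => ⟨fun r => ?_, fun w => ?_, fun μ => ?_, fun w => ?_⟩⟩
  · rintro ⟨h1, h2, h3, h4⟩ ⟨r, w, μ, v⟩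
    rw [D.lagrangianDeriv_apply hτ, h1, h2, h3, h4]
    ring
  · rw [← D.lagrangianDeriv_flux y u, h]
  · rw [← neg_eq_zero, ← D.lagrangianDeriv_state hτ y u, h]
  · rw [← D.lagrangianDeriv_trace hτ y u, h]
  · rw [← D.lagrangianDeriv_control y u p z zo, h]

theorem Data.isDiscreteMinimizer_iff (hΩ : IsOpen Ω)
    (hτ : ∀ i, ∀ s ∈ (T.cell i).halfspaces,
      ∀ᵐ x ∂((surfaceMeasure d).restrict ((T.cell i).facet s)),
        D.τ₂ i s.1 x = D.τ₁ i s.1 x - inner ℝ (D.β x) s.1)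
    (q : Vh d ι k) (y : Wh d ι k) (yo : Mo T k) (u : Wh d ι k) :
    D.IsDiscreteMinimizer q y yo u ↔ ∃ (p : Vh d ι k) (z : Wh d ι k) (zo : Mo T k),
      D.ODSystem q y yo u p z zo := by
  constructor
  · rintro ⟨hfeas, hmin⟩
    -- Kernel directions remain feasible for every real multiple, of either sign, so minimality
    -- forces the linear term of the cost to vanish.
    have hker : ∀ δ, D.stateForm k δ = 0 → D.costDeriv k y u δ = 0 := by
      rintro ⟨r, w, μ, v⟩ hδ
      refine eq_zero_of_forall_le_quadratic (b := 1 / 2 * T.ipForm (T.valL w) (T.valL w)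
          + D.γ / 2 * T.ipForm (T.valL v) (T.valL v)) fun t => ?_
      have hfeas' : D.DOState (q + t • r) (y + t • w) (yo + t • μ) (u + t • v) := by
        rw [D.doState_iff] at hfeas ⊢
        intro p z zo
        have h : ((q + t • r, y + t • w, yo + t • μ, u + t • v) :
            Vh d ι k × Wh d ι k × Mo T k × Wh d ι k) = (q, y, yo, u) + t • (r, w, μ, v) := rfl
        rw [h, map_add, map_smul, hδ, smul_zero, add_zero]
        exact hfeas p z zo
      have h1 := hmin _ _ _ _ hfeas'
      rw [D.cost_add y u (t • w) (t • v) (t • r) (t • μ)] at h1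
      have h2 : ((t • r, t • w, t • μ, t • v) : Vh d ι k × Wh d ι k × Mo T k × Wh d ι k)
          = t • (r, w, μ, v) := rfl
      rw [h2, map_smul] at h1
      simp only [map_smul, LinearMap.smul_apply, smul_eq_mul] at h1
      linarith
    obtain ⟨⟨p, z, zo⟩, hm⟩ := exists_multiplier (D.stateForm k) (D.costDeriv k y u) hker
    exact ⟨p, z, zo, (D.odSystem_iff_lagrangianDeriv hΩ hτ q y yo u p z zo).2 ⟨hfeas, hm⟩⟩
  · rintro ⟨p, z, zo, hod⟩
    obtain ⟨hfeas, hm⟩ := (D.odSystem_iff_lagrangianDeriv hΩ hτ q y yo u p z zo).1 hod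
    refine ⟨hfeas, fun q' y' yo' u' hfeas' => ?_⟩
    have h1 := (D.doState_iff q y yo u).1 hfeas p z zo
    have h2 := (D.doState_iff q' y' yo' u').1 hfeas' p z zo
    have h3 : D.costDeriv k y u (q' - q, y' - y, yo' - yo, u' - u)
        + D.stateForm k (q' - q, y' - y, yo' - yo, u' - u) (p, z, zo) = 0 := hm _
    have h4 : ((q' - q, y' - y, yo' - yo, u' - u) : Vh d ι k × Wh d ι k × Mo T k × Wh d ι k)
        = (q', y', yo', u') - (q, y, yo, u) := rfl
    have h5 := D.cost_add y u (y' - y) (u' - u) (q' - q) (yo' - yo)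
    rw [add_sub_cancel, add_sub_cancel] at h5
    -- Two feasible points have the same value of `stateForm` against the multipliers, so the
    -- first-order change of the cost is zero and only its nonnegative quadratic part remains.
    rw [h4, map_sub (D.stateForm k), LinearMap.sub_apply, ← h4] at h3
    have h6 := ipForm_self_nonneg (T.valL (y' - y))
    have h7 := mul_nonneg D.γ_pos.le (ipForm_self_nonneg (T.valL (u' - u)))
    linarith

end Comparison

end EDG

end

theorem mainTheorem2 {d : ℕ} (hd : 2 ≤ d) (k : ℕ) {Ω : Set (EDG.E d)} (hΩ : IsOpen Ω)
    {ι : Type*} [Fintype ι] (T : EDG.Mesh Ω ι) (D : EDG.Data T)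
    (hτ : ∀ i, ∀ s ∈ (T.cell i).halfspaces,
      ∀ᵐ x ∂((EDG.surfaceMeasure d).restrict ((T.cell i).facet s)),
        D.τ₂ i s.1 x = D.τ₁ i s.1 x - inner ℝ (D.β x) s.1) :
    (∀ (q : EDG.Vh d ι k) (y : EDG.Wh d ι k) (yo : EDG.Mo T k) (u : EDG.Wh d ι k)
        (p : EDG.Vh d ι k) (z : EDG.Wh d ι k) (zo : EDG.Mo T k),
      (∃ L : EDG.Vh d ι k →L[ℝ] ℝ,
        HasFDerivAt (fun q' => D.lagrangian q' y yo u p z zo) L q ∧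
          ∀ r, L r = EDG.odAdjFlux p z zo r) ∧
      (∃ L : EDG.Wh d ι k →L[ℝ] ℝ,
        HasFDerivAt (fun y' => D.lagrangian q y' yo u p z zo) L y ∧
          ∀ w, L w = -D.odAdjState y p z zo w) ∧
      (∃ L : EDG.Mo T k →L[ℝ] ℝ,
        HasFDerivAt (fun yo' => D.lagrangian q y yo' u p z zo) L yo ∧
          ∀ μ, L μ = D.odAdjTrace p z zo μ) ∧
      (∃ L : EDG.Wh d ι k →L[ℝ] ℝ,
        HasFDerivAt (fun u' => D.lagrangian q y yo u' p z zo) L u ∧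
          ∀ w, L w = D.odControl u z w)) ∧
    (∀ (q : EDG.Vh d ι k) (y : EDG.Wh d ι k) (yo : EDG.Mo T k) (u : EDG.Wh d ι k)
        (p : EDG.Vh d ι k) (z : EDG.Wh d ι k) (zo : EDG.Mo T k),
      D.DOSystem q y yo u p z zo ↔ D.ODSystem q y yo u p z zo) ∧
    (∀ (q : EDG.Vh d ι k) (y : EDG.Wh d ι k) (yo : EDG.Mo T k) (u : EDG.Wh d ι k),
      D.IsDiscreteMinimizer q y yo u ↔
        ∃ (p : EDG.Vh d ι k) (z : EDG.Wh d ι k) (zo : EDG.Mo T k),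
          D.ODSystem q y yo u p z zo) :=
  ⟨fun q y yo u p z zo => ⟨D.hasFDerivAt_lagrangian_flux q y yo u p z zo,
    D.hasFDerivAt_lagrangian_state hτ q y yo u p z zo,
    D.hasFDerivAt_lagrangian_trace hτ q y yo u p z zo,
    D.hasFDerivAt_lagrangian_control q y yo u p z zo⟩,
  D.doSystem_iff_odSystem hΩ hτ, D.isDiscreteMinimizer_iff hΩ hτ⟩
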